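/- Let $\mathcal{C}$ be one of two classes of groups with a bi-invariant metric. Either $\mathcal{C}=\mathcal{C}_{HS}$, the unitary groups $\mathrm{Aut}(X)=U(X)$ of the nonzero finite-dimensional complex Hilbert spaces $X$, with $d(a,b)=\|a-b\|_{HS,X}$, where $\|A\|_{HS,X}=\big(\tfrac{1}{\dim X}\mathrm{Tr}(A^*A)\big)^{1/2}$; put $|X|=\dim X$ and $s=\tfrac12$. Or $\mathcal{C}=\mathcal{C}_P$, the symmetric groups $\mathrm{Aut}(X)=\mathrm{Sym}(X)$ of the nonempty finite sets $X$, with $d(\sigma,\tau)=\tfrac{1}{|X|}\#\{x\in X:\sigma(x)\neq\tau(x)\}$; put $s=1$. For a group $G$: * An asymptotic homomorphism is a sequence of maps $\varphi_n\colon G\to\mathrm{Aut}(X_n)\in\mathcal{C}$ with $d(\varphi_n(a)\varphi_n(b),\varphi_n(ab))\to 0$ for all $a,b\in G$. * $G$ is $\mathcal{C}$-stable if for every asymptotic homomorphism $(\varphi_n)$ there are homomorphisms $\psi_n\colon G\to\mathrm{Aut}(X_n)$ with $d(\varphi_n(a),\psi_n(a))\to 0$ for all $a\in G$. * $G$ is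 flexibly $\mathcal{C}$-stable if for every asymptotic homomorphism $(\varphi_n)$ there are $Y_n\supseteq X_n$ (finite-dimensional Hilbert spaces, respectively finite sets) and homomorphisms $\psi_n\colon G\to\mathrm{Aut}(Y_n)$ such that $|Y_n|/|X_n|\to 1$ and, for all $a\in G$: in the case $\mathcal{C}_{HS}$, $\|\varphi_n(a)-p_n\psi_n(a)p_n\|_{HS,X_n}\to 0$, where $p_n$ is the orthogonal projection of $Y_n$ onto $X_n$ and $p_n\psi_n(a)p_n$ is regarded as an operator on $X_n$; in the case $\mathcal{C}_P$, $\tfrac{1}{|X_n|}\#\{x\in X_n:\varphi_n(a)(x)\neq\psi_n(a)(x)\}\to 0$. * $G$ is $\mathcal{C}$-approximated if for every $\varepsilon>0$ and every finite $F\subseteq G$ there is a map $\varphi\colon G\to\mathrm{Aut}(X)\in\mathcal{C}$ with $d(\varphi(g)\varphi(h),\varphi(gh))\le\varepsilon$ whenever $g,h,gh\in F$, and $d(\varphi(g),1_X)\ge 2^{1-s}-\varepsilon$ for all $g\in F\setminus\{1\}$. * $\Lambda(G)$ is the free abelian group on the set of isomorphism classes of irreducible finite-dimensional unitary representations of $G$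 (case $\mathcal{C}_{HS}$), respectively of transitive actions of $G$ on nonempty finite sets (case $\mathcal{C}_P$). **Theorem.** Let $\mathcal{C}$ be $\mathcal{C}_{HS}$ or $\mathcal{C}_P$. Let $G_1$ and $G_2$ be finitely generated groups that are $\mathcal{C}$-approximated and $\mathcal{C}$-stable, and let $H$ be a group with $\mathrm{rank}\,\Lambda(H)=2$. Then for any injective homomorphisms $i_1\colon H\to G_1$ and $i_2\colon H\to G_2$ the amalgamated free product $G_1*_HG_2=(G_1*G_2)/\langle\langle i_1(h)i_2(h)^{-1}:h\in H\rangle\rangle$ is flexibly $\mathcal{C}$-stable. -/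

import Mathlib

/-- A nonzero finite-dimensional complex Hilbert space. -/
structure FDHilb : Type 1 where
  carrier : Type
  [normed : NormedAddCommGroup carrier]
  [inner : InnerProductSpace ℂ carrier]
  [finiteDim : FiniteDimensional ℂ carrier]
  [nontriv : Nontrivial carrier]

/-- A nonempty finite set. -/
structure FinSet : Type 1 where
  carrier : Type
  [fin : Finite carrier]
  [nonemp : Nonempty carrier]

instance : CoeSort FDHilb Type := ⟨FDHilb.carrier⟩

instance : CoeSort FinSet Type := ⟨FinSet.carrier⟩

attribute [instance] FDHilb.normed FDHilb.inner FDHilb.finiteDim FDHilb.nontriv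

attribute [instance] FinSet.fin FinSet.nonemp

/-- The Hilbert–Schmidt norm `(tr (A* A) / dim X) ^ (1 / 2)` with respect to the normalized
trace. -/
noncomputable def hsNorm (X : FDHilb) (A : X →ₗ[ℂ] X) : ℝ :=
  Real.sqrt ((LinearMap.trace ℂ X (LinearMap.adjoint A ∘ₗ A)).re / Module.finrank ℂ X)

/-- The group of unitary operators of `X`, with composition. -/
abbrev UAut (X : FDHilb) : Type := X ≃ₗᵢ[ℂ] X

/-- The group of permutations of `X`. -/
abbrev PAut (X : FinSet) : Type := Equiv.Perm X

/-- A unitary operator as a linear map. -/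
def UAut.lin {X : FDHilb} (U : UAut X) : X →ₗ[ℂ] X := U.toLinearEquiv.toLinearMap

/-- The normalized Hilbert–Schmidt distance on the unitary group. -/
noncomputable def hsDist (X : FDHilb) (U V : UAut X) : ℝ :=
  hsNorm X (U.lin - V.lin)

/-- The normalized Hamming distance on the symmetric group. -/
noncomputable def hammDist (X : FinSet) (σ τ : PAut X) : ℝ :=
  ({x : X | σ x ≠ τ x}.ncard : ℝ) / Nat.card X

section Stability

/-- `φ` is an asymptotic homomorphism from `G` to the groups `Aut (X n)`, with respect to the
distances `d`. -/
def IsAsymptoticHom {Obj : Type*} (Aut : Obj → Type*) [∀ X, Group (Aut X)]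
    (d : ∀ X, Aut X → Aut X → ℝ) {G : Type*} [Group G] (X : ℕ → Obj)
    (φ : ∀ n, G → Aut (X n)) : Prop :=
  ∀ a b : G, Filter.Tendsto (fun n => d (X n) (φ n a * φ n b) (φ n (a * b)))
    Filter.atTop (nhds 0)

/-- Stability of the group `G` with respect to the class of groups `Aut X` with distances
`d X`: every asymptotic homomorphism is pointwise asymptotically close to a sequence of
homomorphisms to the same groups. -/
def IsStable {Obj : Type*} (Aut : Obj → Type*) [∀ X, Group (Aut X)]
    (d : ∀ X, Aut X → Aut X → ℝ) (G : Type*) [Group G] : Prop :=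
  ∀ (X : ℕ → Obj) (φ : ∀ n, G → Aut (X n)), IsAsymptoticHom Aut d X φ →
    ∃ ψ : ∀ n, G →* Aut (X n), ∀ a : G,
      Filter.Tendsto (fun n => d (X n) (φ n a) (ψ n a)) Filter.atTop (nhds 0)

/-- The group `G` is approximated by the class of groups `Aut X` with distances `d X`; the
exponent `s` is `1 / 2` for Hilbert–Schmidt distances and `1` for Hamming distances. -/
def IsApproximated {Obj : Type*} (Aut : Obj → Type*) [∀ X, Group (Aut X)]
    (d : ∀ X, Aut X → Aut X → ℝ) (s : ℝ) (G : Type*) [Group G] : Prop :=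
  ∀ ε : ℝ, 0 < ε → ∀ F : Finset G, ∃ (X : Obj) (φ : G → Aut X),
    (∀ g ∈ F, ∀ h ∈ F, g * h ∈ F → d X (φ g * φ h) (φ (g * h)) ≤ ε) ∧
    (∀ g ∈ F, g ≠ 1 → (2 : ℝ) ^ (1 - s) - ε ≤ d X (φ g) 1)

end Stability

/-- Hilbert–Schmidt stability. -/
def IsHSStable (G : Type*) [Group G] : Prop := IsStable UAut hsDist G

/-- Stability in permutations. -/
def IsPStable (G : Type*) [Group G] : Prop := IsStable PAut hammDist G

/-- Approximability by unitary groups with Hilbert–Schmidt distances (hyperlinearity). -/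
def IsHSApproximated (G : Type*) [Group G] : Prop := IsApproximated UAut hsDist (1 / 2) G

/-- Approximability by permutations (soficity). -/
def IsPApproximated (G : Type*) [Group G] : Prop := IsApproximated PAut hammDist 1 G

/-- The compression `p a p`, as an operator on `X`, of a unitary operator `a` of `Y`, where `X` is
a subspace of `Y` through the isometric inclusion `ι` and `p` is the projection onto it. -/
noncomputable def compression {X Y : FDHilb} (ι : X →ₗᵢ[ℂ] Y) (a : UAut Y) : X →ₗ[ℂ] X :=
  LinearMap.adjoint ι.toLinearMap ∘ₗ a.lin ∘ₗ ι.toLinearMap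

/-- Flexible Hilbert–Schmidt stability: every asymptotic homomorphism `φ` to unitary groups of
spaces `X n` is asymptotically close to the compressions of unitary representations on larger
spaces `Y n ⊇ X n` with `dim (Y n) / dim (X n) → 1`. -/
def IsFlexiblyHSStable (G : Type*) [Group G] : Prop :=
  ∀ (X : ℕ → FDHilb) (φ : ∀ n, G → UAut (X n)), IsAsymptoticHom UAut hsDist X φ →
    ∃ (Y : ℕ → FDHilb) (ι : ∀ n, X n →ₗᵢ[ℂ] Y n) (ψ : ∀ n, G →* UAut (Y n)),
      (∀ a : G, Filter.Tendsto
        (fun n => hsNorm (X n) ((φ n a).lin - compression (ι n) (ψ n a)))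
        Filter.atTop (nhds 0)) ∧
      Filter.Tendsto
        (fun n => (Module.finrank ℂ (Y n) : ℝ) / (Module.finrank ℂ (X n) : ℝ))
        Filter.atTop (nhds 1)

/-- Flexible stability in permutations: every asymptotic homomorphism `φ` to symmetric groups of
sets `X n` is asymptotically close, on `X n`, to actions on larger sets `Y n ⊇ X n` with
`|Y n| / |X n| → 1`. -/
def IsFlexiblyPStable (G : Type*) [Group G] : Prop :=
  ∀ (X : ℕ → FinSet) (φ : ∀ n, G → PAut (X n)), IsAsymptoticHom PAut hammDist X φ →
    ∃ (Y : ℕ → FinSet) (ι : ∀ n, X n ↪ Y n) (ψ : ∀ n, G →* PAut (Y n)),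
      (∀ a : G, Filter.Tendsto
        (fun n => ({x : X n | ι n (φ n a x) ≠ ψ n a (ι n x)}.ncard : ℝ) / Nat.card (X n))
        Filter.atTop (nhds 0)) ∧
      Filter.Tendsto (fun n => (Nat.card (Y n) : ℝ) / (Nat.card (X n) : ℝ))
        Filter.atTop (nhds 1)

/-- An irreducible finite-dimensional unitary representation (it is nonzero, as `FDHilb` consists
of nonzero spaces). -/
structure IrrUnitaryRep (G : Type*) [Group G] where
  space : FDHilb
  hom : G →* UAut space
  irreducible : ∀ W : Submodule ℂ space, (∀ g : G, ∀ w ∈ W, hom g w ∈ W) → W = ⊥ ∨ W = ⊤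

/-- A transitive action on a nonempty finite set. -/
structure TransitiveAction (G : Type*) [Group G] where
  space : FinSet
  hom : G →* PAut space
  transitive : ∀ x y : space, ∃ g : G, hom g x = y

/-- Unitary equivalence of irreducible unitary representations. -/
def IrrUnitaryRep.setoid (G : Type*) [Group G] : Setoid (IrrUnitaryRep G) where
  r A B := ∃ T : A.space ≃ₗᵢ[ℂ] B.space, ∀ g x, T (A.hom g x) = B.hom g (T x)
  iseqv :=
    { refl := fun A => ⟨LinearIsometryEquiv.refl ℂ A.space, fun _ _ => rfl⟩
      symm := by
        rintro A B ⟨T, hT⟩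
        refine ⟨T.symm, fun g x => ?_⟩
        rw [LinearIsometryEquiv.symm_apply_eq, hT, LinearIsometryEquiv.apply_symm_apply]
      trans := by
        rintro A B C ⟨T, hT⟩ ⟨S, hS⟩
        refine ⟨T.trans S, fun g x => ?_⟩
        simp only [LinearIsometryEquiv.trans_apply, hT, hS] }

/-- Isomorphism of transitive actions. -/
def TransitiveAction.setoid (G : Type*) [Group G] : Setoid (TransitiveAction G) where
  r A B := ∃ T : A.space ≃ B.space, ∀ g x, T (A.hom g x) = B.hom g (T x)
  iseqv :=
    { refl := fun A => ⟨Equiv.refl A.space, fun _ _ => rfl⟩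
      symm := by
        rintro A B ⟨T, hT⟩
        refine ⟨T.symm, fun g x => ?_⟩
        rw [Equiv.symm_apply_eq, hT, Equiv.apply_symm_apply]
      trans := by
        rintro A B C ⟨T, hT⟩ ⟨S, hS⟩
        refine ⟨T.trans S, fun g x => ?_⟩
        simp only [Equiv.trans_apply, hT, hS] }

/-- The set of isomorphism classes of irreducible finite-dimensional unitary representations. -/
def IrrHS (G : Type*) [Group G] := Quotient (IrrUnitaryRep.setoid G)

/-- The set of isomorphism classes of transitive actions on finite sets. -/
def IrrP (G : Type*) [Group G] := Quotient (TransitiveAction.setoid G)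

/-- The free abelian group on the classes of irreducible unitary representations (the additive
group of the representation ring). -/
abbrev LambdaHS (G : Type*) [Group G] := IrrHS G →₀ ℤ

/-- The free abelian group on the classes of transitive finite actions (the additive group of the
Burnside ring). -/
abbrev LambdaP (G : Type*) [Group G] := IrrP G →₀ ℤ

/-- The amalgamated free product: the quotient of the free product `G₁ * G₂` by the normal closure
of the elements `i₁(h) i₂(h)⁻¹`. -/
abbrev AmalgamatedProduct {G₁ G₂ H : Type*} [Group G₁] [Group G₂] [Group H]
    (i₁ : H →* G₁) (i₂ : H →* G₂) :=
  Monoid.Coprod G₁ G₂ ⧸ Subgroup.normalClosure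
    (Set.range fun h : H =>
      (Monoid.Coprod.inl (i₁ h) : Monoid.Coprod G₁ G₂) * (Monoid.Coprod.inr (i₂ h))⁻¹)

/-! Approximation together with stability gives every nontrivial element of `G₁` or `G₂` a
nontrivial image under some genuine homomorphism into the class (`exists_hom_ne_one`); by
injectivity this passes to `H`. Having only two classes of irreducibles, one of them trivial, then
forces `H` to be cyclic, generated by some `h₀` of prime order `p` for permutations and of order 2
for unitaries. An action of `H` on a given space is therefore determined up to conjugacy by one
integer: the number of points moved by `h₀`, or the dimension of its `-1`-eigenspace.

An asymptotic homomorphism of the amalgam restricts to both factors, and stability replaces the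
restrictions by homomorphisms `ψ₁`, `ψ₂` whose values at `h₀` are asymptotically equal. The two
integers then differ by `o(|X n|)`, but they need not agree. The difference is cancelled by adding a
small summand on which both factors act with the opposite difference. The achievable pairs
(difference, size) form a submonoid of `ℤ × ℕ`, and separation provides differences of both signs,
so `AddSubmonoid.exists_neg_fst_mem` yields a correction of size linear in the difference. Hence `|Y
n| / |X n|` tends to 1; this is where flexibility is needed.

Once the integers agree, the two images of `h₀` are conjugate, and since they are close the
conjugator can be taken close to 1 (`Equiv.Perm.exists_conj_of_movedCard_eq`,
`exists_conj_of_negDim_eq`). Conjugating the first action by it makes the two agree exactly on `H`,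
and they glue to a homomorphism of the amalgam (`exists_amalgam_hom`). -/

open Filter Topology Module

/-! ### Bi-invariant distances and separation of points -/

/-- The distances `d X` on the groups `Aut X` are bi-invariant pseudometrics. -/
structure IsBiinvariantDist {Obj : Type*} (Aut : Obj → Type*) [∀ X, Group (Aut X)]
    (d : ∀ X, Aut X → Aut X → ℝ) : Prop where
  self : ∀ X a, d X a a = 0
  nonneg : ∀ X a b, 0 ≤ d X a b
  comm : ∀ X a b, d X a b = d X b a
  triangle : ∀ X a b c, d X a c ≤ d X a b + d X b c
  mul_left : ∀ X a b c, d X (c * a) (c * b) = d X a b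
  mul_right : ∀ X a b c, d X (a * c) (b * c) = d X a b

namespace IsBiinvariantDist

variable {Obj : Type*} {Aut : Obj → Type*} [∀ X, Group (Aut X)] {d : ∀ X, Aut X → Aut X → ℝ}

theorem mul_mul_le (hd : IsBiinvariantDist Aut d) (X : Obj) (a b a' b' : Aut X) :
    d X (a * b) (a' * b') ≤ d X a a' + d X b b' := by
  have h := hd.triangle X (a * b) (a' * b) (a' * b')
  rwa [hd.mul_right, hd.mul_left] at h

/-- By right invariance the distance is that from `a * w` to `w * a`, and each of these is within `d
X w 1` of `a`. -/
theorem conj_le (hd : IsBiinvariantDist Aut d) (X : Obj) (a w : Aut X) :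
    d X a (w * a * w⁻¹) ≤ 2 * d X w 1 := by
  have h := hd.mul_mul_le X a w w a
  have h' := hd.mul_right X a (w * a * w⁻¹) w
  rw [inv_mul_cancel_right] at h'
  have h1 := hd.triangle X (a * w) a (w * a)
  have h2 := hd.mul_left X w 1 a
  have h3 := hd.mul_right X 1 w a
  rw [mul_one] at h2
  rw [one_mul, hd.comm X 1 w] at h3
  linarith

/-- Approximations along an exhaustion of the countable group form an asymptotic homomorphism that
keeps `g` away from 1, so nearby homomorphisms cannot all kill `g`. Of the constant `2 ^ (1 - s)`
only positivity matters. -/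
theorem exists_hom_ne_one (hd : IsBiinvariantDist Aut d) {G : Type*} [Group G] [Countable G]
    {s : ℝ} (happ : IsApproximated Aut d s G) (hst : IsStable Aut d G) {g : G} (hg : g ≠ 1) :
    ∃ (X : Obj) (ψ : G →* Aut X), ψ g ≠ 1 := by
  classical
  obtain ⟨f, hf⟩ := exists_surjective_nat G
  let F : ℕ → Finset G := fun n => (Finset.range n).image f
  have hF : ∀ a : G, ∀ᶠ n in atTop, a ∈ F n := by
    intro a
    obtain ⟨k, rfl⟩ := hf a
    filter_upwards [eventually_gt_atTop k] with n hn
    exact Finset.mem_image_of_mem f (Finset.mem_range.2 hn)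
  choose X φ h1 h2 using fun n : ℕ => happ (1 / ((n : ℝ) + 1)) (by positivity) (F n)
  have hlim : Tendsto (fun n : ℕ => 1 / ((n : ℝ) + 1)) atTop (𝓝 0) :=
    tendsto_one_div_add_atTop_nhds_zero_nat
  have hφ : IsAsymptoticHom Aut d X φ := by
    intro a b
    refine squeeze_zero' (Eventually.of_forall fun n => hd.nonneg _ _ _) ?_ hlim
    filter_upwards [hF a, hF b, hF (a * b)] with n ha hb hab
    exact h1 n a ha b hb hab
  obtain ⟨ψ, hψ⟩ := hst X φ hφ
  by_contra! hcon
  have hpos : (0 : ℝ) < 2 ^ (1 - s) := Real.rpow_pos_of_pos two_pos _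
  have hsum : Tendsto (fun n : ℕ => d (X n) (φ n g) (ψ n g) + 1 / ((n : ℝ) + 1)) atTop
      (𝓝 (0 + 0)) := (hψ g).add hlim
  rw [add_zero] at hsum
  obtain ⟨n, hn, hgn⟩ := ((hsum.eventually (gt_mem_nhds hpos)).and (hF g)).exists
  have := h2 n g hgn hg
  rw [hcon (X n) (ψ n)] at hn
  linarith

end IsBiinvariantDist

theorem Group.FG.countable (G : Type*) [Group G] [h : Group.FG G] : Countable G := by
  obtain ⟨S, hS⟩ := Group.fg_iff.1 h
  obtain ⟨hS, hfin⟩ := hS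
  have : Countable S := hfin.countable
  have hsurj : Function.Surjective (FreeGroup.lift ((↑) : S → G)) := by
    rw [← MonoidHom.range_eq_top, FreeGroup.range_lift_eq_closure, Subtype.range_coe, hS]
  have : Countable (FreeGroup S) := inferInstanceAs (Countable (Quot _))
  exact hsurj.countable

/-! ### Homomorphisms out of the amalgamated product -/

namespace AmalgamatedProduct

variable {G₁ G₂ H A : Type*} [Group G₁] [Group G₂] [Group H] [Group A]
  (i₁ : H →* G₁) (i₂ : H →* G₂)

/-- The inclusion of the first factor. -/
def inl : G₁ →* AmalgamatedProduct i₁ i₂ := (QuotientGroup.mk' _).comp Monoid.Coprod.inl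

/-- The inclusion of the second factor. -/
def inr : G₂ →* AmalgamatedProduct i₁ i₂ := (QuotientGroup.mk' _).comp Monoid.Coprod.inr

theorem inl_eq_inr (h : H) : inl i₁ i₂ (i₁ h) = inr i₁ i₂ (i₂ h) := by
  rw [← mul_inv_eq_one]
  exact (QuotientGroup.eq_one_iff _).2 (Subgroup.subset_normalClosure ⟨h, rfl⟩)

variable {i₁ i₂}

theorem induction_on {p : AmalgamatedProduct i₁ i₂ → Prop} (x : AmalgamatedProduct i₁ i₂)
    (hl : ∀ g, p (inl i₁ i₂ g)) (hr : ∀ g, p (inr i₁ i₂ g))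
    (hmul : ∀ x y, p x → p y → p (x * y)) : p x := by
  induction x using QuotientGroup.induction_on with
  | H z =>
    induction z using Monoid.Coprod.induction_on with
    | inl m => exact hl m
    | inr n => exact hr n
    | mul x y hx hy => exact hmul _ _ hx hy

theorem exists_lift (f₁ : G₁ →* A) (f₂ : G₂ →* A) (h : ∀ x, f₁ (i₁ x) = f₂ (i₂ x)) :
    ∃ f : AmalgamatedProduct i₁ i₂ →* A,
      (∀ g, f (inl i₁ i₂ g) = f₁ g) ∧ ∀ g, f (inr i₁ i₂ g) = f₂ g := by
  refine ⟨QuotientGroup.lift _ (Monoid.Coprod.lift f₁ f₂) ?_, fun g => ?_, fun g => ?_⟩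
  · refine Subgroup.normalClosure_le_normal ?_
    rintro _ ⟨x, rfl⟩
    rw [SetLike.mem_coe]
    simp [MonoidHom.mem_ker, h x]
  · exact Monoid.Coprod.lift_apply_inl f₁ f₂ g
  · exact Monoid.Coprod.lift_apply_inr f₁ f₂ g

end AmalgamatedProduct

namespace IsBiinvariantDist

variable {Obj : Type*} {Aut : Obj → Type*} [∀ X, Group (Aut X)] {d : ∀ X, Aut X → Aut X → ℝ}
  {G₁ G₂ H : Type*} [Group G₁] [Group G₂] [Group H] {i₁ : H →* G₁} {i₂ : H →* G₂}

/-- Conjugation by `W n` makes `ψ₁ n` match `ψ₂ n` on `H` at a cost of at most `2 * d (W n) 1`.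
Closeness on the two factors spreads to products because `φ` is asymptotically multiplicative. -/
theorem exists_amalgam_hom (hd : IsBiinvariantDist Aut d) {Y : ℕ → Obj}
    {φ : ∀ n, AmalgamatedProduct i₁ i₂ → Aut (Y n)} (hφ : IsAsymptoticHom Aut d Y φ)
    (ψ₁ : ∀ n, G₁ →* Aut (Y n)) (ψ₂ : ∀ n, G₂ →* Aut (Y n)) (W : ∀ n, Aut (Y n))
    (h₁ : ∀ g, Tendsto (fun n => d (Y n) (φ n (AmalgamatedProduct.inl i₁ i₂ g)) (ψ₁ n g))
      atTop (𝓝 0))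
    (h₂ : ∀ g, Tendsto (fun n => d (Y n) (φ n (AmalgamatedProduct.inr i₁ i₂ g)) (ψ₂ n g))
      atTop (𝓝 0))
    (hW : Tendsto (fun n => d (Y n) (W n) 1) atTop (𝓝 0))
    (hconj : ∀ n h, W n * ψ₁ n (i₁ h) * (W n)⁻¹ = ψ₂ n (i₂ h)) :
    ∃ ψ : ∀ n, AmalgamatedProduct i₁ i₂ →* Aut (Y n),
      ∀ a, Tendsto (fun n => d (Y n) (φ n a) (ψ n a)) atTop (𝓝 0) := by
  choose ψ hl hr using fun n => AmalgamatedProduct.exists_lift (i₁ := i₁) (i₂ := i₂)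
    ((MulAut.conj (W n)).toMonoidHom.comp (ψ₁ n)) (ψ₂ n) (hconj n)
  refine ⟨ψ, fun a => ?_⟩
  induction a using AmalgamatedProduct.induction_on with
  | hl g =>
    have hlim := (h₁ g).add (hW.const_mul 2)
    rw [mul_zero, add_zero] at hlim
    refine squeeze_zero (fun n => hd.nonneg _ _ _) (fun n => ?_) hlim
    rw [hl]
    exact (hd.triangle _ _ (ψ₁ n g) _).trans (by gcongr; exact hd.conj_le _ _ _)
  | hr g => simpa only [hr] using h₂ g
  | hmul x y hx hy =>
    have hlim := (hφ x y).add (hx.add hy)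
    rw [add_zero, add_zero] at hlim
    refine squeeze_zero (fun n => hd.nonneg _ _ _) (fun n => ?_) hlim
    rw [map_mul, hd.comm (Y n) (φ n x * φ n y)]
    exact (hd.triangle _ _ (φ n x * φ n y) _).trans (by gcongr; exact hd.mul_mul_le _ _ _ _ _)

end IsBiinvariantDist

/-! ### Arithmetic of the correction terms -/

/-- A submonoid of `ℤ × ℕ` with first coordinates of both signs contains, for each of its
elements `(m, k)`, an element `(-m, l)` with `l` bounded linearly in `|m|`. -/
theorem AddSubmonoid.exists_neg_fst_mem (R : AddSubmonoid (ℤ × ℕ)) {p q : ℤ × ℕ}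
    (hp : p ∈ R) (hp' : 0 < p.1) (hq : q ∈ R) (hq' : q.1 < 0) :
    ∃ C : ℝ, 0 ≤ C ∧ ∀ x ∈ R, ∃ l : ℕ, (-x.1, l) ∈ R ∧ (l : ℝ) ≤ C * |(x.1 : ℝ)| := by
  obtain ⟨p, p'⟩ := p
  obtain ⟨q, q'⟩ := q
  have hmul : ∀ (n : ℕ) (a : ℤ) (b : ℕ), (a, b) ∈ R → (n * a, n * b) ∈ R := fun n a b h => by
    simpa only [Prod.smul_mk, nsmul_eq_mul, Nat.cast_id] using R.nsmul_mem h n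
  have hneg : ∀ m : ℤ, (∃ k, (m, k) ∈ R) → ∃ k, (-m, k) ∈ R := by
    rintro m ⟨k, hk⟩
    rcases lt_trichotomy m 0 with hm | rfl | hm
    -- With `p = a + 1` and `m = -b`, taking `b` copies of `p` and `a` copies of `m` gives `b * (a +
    -- 1) - a * b = b = -m`. The case `0 < m` is symmetric, with `q`.
    · lift p to ℕ using hp'.le
      obtain ⟨a, rfl⟩ := Nat.exists_eq_add_of_lt (Nat.cast_pos.1 hp')
      obtain ⟨b, hb⟩ := Int.eq_ofNat_of_zero_le (neg_nonneg.2 hm.le)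
      obtain rfl : m = -(b : ℤ) := by omega
      have := R.add_mem (hmul b _ _ hp) (hmul a _ _ hk)
      rw [Prod.mk_add_mk] at this
      refine ⟨b * p' + a * k, ?_⟩
      convert this using 2
      push_cast
      ring
    · exact ⟨0, R.zero_mem⟩
    · obtain ⟨b, hb⟩ := Int.eq_ofNat_of_zero_le (neg_nonneg.2 hq'.le)
      obtain rfl : q = -(b : ℤ) := by omega
      obtain ⟨a, rfl⟩ := Nat.exists_eq_add_of_lt (show 0 < b by simp at hq'; omega)
      lift m to ℕ using hm.le
      have := R.add_mem (hmul m _ _ hq) (hmul a _ _ hk)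
      rw [Prod.mk_add_mk] at this
      refine ⟨m * q' + a * k, ?_⟩
      convert this using 2
      push_cast
      ring
  -- Closed under negation, the first coordinates form a subgroup `ℤ c`. Fixed witnesses for `c` and
  -- `-c` then suffice: an element `n * c` is cancelled by `|n|` copies of one of them.
  let S : AddSubgroup ℤ :=
    { carrier := {m | ∃ k, (m, k) ∈ R}
      add_mem' := fun ⟨k, hk⟩ ⟨l, hl⟩ => ⟨k + l, R.add_mem hk hl⟩
      zero_mem' := ⟨0, R.zero_mem⟩
      neg_mem' := fun {m} hm => hneg m hm }
  obtain ⟨c, hc⟩ := Int.subgroup_cyclic S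
  have hcS : c ∈ S := by rw [hc]; exact AddSubgroup.mem_closure_singleton_self c
  obtain ⟨k₁, hk₁⟩ := id hcS
  obtain ⟨k₂, hk₂⟩ := S.neg_mem hcS
  refine ⟨k₁ + k₂, by positivity, fun x hx => ?_⟩
  have hxS : x.1 ∈ S := ⟨x.2, hx⟩
  rw [hc, AddSubgroup.mem_closure_singleton] at hxS
  obtain ⟨n, hn⟩ := hxS
  have hc0 : c ≠ 0 := by
    rintro rfl
    have : p ∈ S := ⟨p', hp⟩
    rw [hc, AddSubgroup.mem_closure_singleton] at this
    obtain ⟨n, hn⟩ := this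
    simp only [smul_zero] at hn
    omega
  -- Since `c` is a nonzero integer, the number of copies is at most `|x.1|`; hence the constant `k₁
  -- + k₂`.
  have hle : ((n.natAbs : ℕ) : ℝ) ≤ |(x.1 : ℝ)| := by
    rw [← hn, smul_eq_mul, Int.cast_mul, abs_mul, Nat.cast_natAbs, Int.cast_abs]
    refine le_mul_of_one_le_right (abs_nonneg _) ?_
    exact_mod_cast Int.one_le_abs hc0
  rcases le_total 0 n with h0 | h0
  · lift n to ℕ using h0
    refine ⟨n * k₂, ?_, ?_⟩
    · rw [← hn, smul_eq_mul, ← mul_neg]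
      exact hmul n _ _ hk₂
    · rw [Nat.cast_mul, mul_comm]
      rw [Int.natAbs_natCast] at hle
      gcongr
      simp
  · obtain ⟨n, rfl⟩ := Int.exists_eq_neg_ofNat h0
    refine ⟨n * k₁, ?_, ?_⟩
    · rw [← hn, smul_eq_mul, neg_mul, neg_neg]
      exact hmul n _ _ hk₁
    · rw [Nat.cast_mul, mul_comm]
      rw [Int.natAbs_neg, Int.natAbs_natCast] at hle
      gcongr
      simp

theorem MonoidHom.conj_eq_of_forall_mem_zpowers {H A : Type*} [Group H] [Group A]
    {f₁ f₂ : H →* A} {w : A} {h₀ : H} (hgen : ∀ h, h ∈ Subgroup.zpowers h₀)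
    (hw : w * f₁ h₀ * w⁻¹ = f₂ h₀) (h : H) : w * f₁ h * w⁻¹ = f₂ h := by
  obtain ⟨k, rfl⟩ := Subgroup.mem_zpowers_iff.1 (hgen h)
  rw [map_zpow, map_zpow, ← hw, conj_zpow]

theorem exists_ne_and_forall_eq_or_eq_of_rank_eq_two {ι : Type*}
    (h : Module.rank ℤ (ι →₀ ℤ) = 2) (t : ι) : ∃ a, a ≠ t ∧ ∀ b, b = t ∨ b = a := by
  have h2 : Cardinal.mk ι = 2 := by
    have h3 := (Finsupp.basisSingleOne (R := ℤ) (ι := ι)).mk_eq_rank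
    rw [h] at h3
    simpa using h3
  obtain ⟨a, ha, huniq⟩ := (Cardinal.mk_eq_two_iff' t).1 h2
  exact ⟨a, ha, fun b => or_iff_not_imp_left.2 (huniq b)⟩

/-! ### Hamming distance and conjugacy of permutations of prime order -/

theorem isBiinvariantDist_hammDist : IsBiinvariantDist PAut hammDist where
  self X a := by simp [hammDist]
  nonneg X a b := by unfold hammDist; positivity
  comm X a b := by simp only [hammDist, ne_comm]
  triangle X a b c := by
    unfold hammDist
    rw [← add_div]
    gcongr
    norm_cast
    refine (Set.ncard_le_ncard ?_).trans (Set.ncard_union_le _ _)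
    intro x hx
    by_cases h : a x = b x
    · exact Or.inr fun h' => hx (h.trans h')
    · exact Or.inl h
  mul_left X a b c := by simp [hammDist]
  mul_right X a b c := by
    unfold hammDist
    congr 2
    exact Set.ncard_preimage_of_injective_subset_range (s := {x | a x ≠ b x}) c.injective
      (by simp [c.surjective.range_eq])

namespace Equiv.Perm

variable {α β : Type*}

/-- The number of points moved by a permutation. -/
noncomputable def movedCard (σ : Equiv.Perm α) : ℕ := {x | σ x ≠ x}.ncard

theorem movedCard_eq_card_support [Fintype α] [DecidableEq α] (σ : Equiv.Perm α) :
    σ.movedCard = σ.support.card := by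
  rw [movedCard, ← Set.ncard_coe_finset]
  congr 1
  ext
  simp

@[simp] theorem movedCard_one : (1 : Equiv.Perm α).movedCard = 0 := by simp [movedCard]

theorem movedCard_pos [Finite α] {σ : Equiv.Perm α} (h : σ ≠ 1) : 0 < σ.movedCard := by
  obtain ⟨x, hx⟩ : ∃ x, σ x ≠ x := by
    by_contra! hcon
    exact h (Equiv.ext hcon)
  exact (Set.ncard_pos).2 ⟨x, hx⟩

theorem ncard_sum [Finite α] [Finite β] (s : Set (α ⊕ β)) :
    s.ncard = (Sum.inl ⁻¹' s).ncard + (Sum.inr ⁻¹' s).ncard := by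
  rw [← Set.ncard_image_of_injective (Sum.inl ⁻¹' s) Sum.inl_injective,
    ← Set.ncard_image_of_injective (Sum.inr ⁻¹' s) Sum.inr_injective, ← Set.ncard_union_eq,
    Set.image_preimage_inl_union_image_preimage_inr]
  rw [Set.disjoint_left]
  rintro _ ⟨x, -, rfl⟩ ⟨y, -, h⟩
  cases h

theorem movedCard_sumCongr [Finite α] [Finite β] (σ : Equiv.Perm α) (τ : Equiv.Perm β) :
    (Equiv.Perm.sumCongr σ τ).movedCard = σ.movedCard + τ.movedCard := by
  rw [movedCard, ncard_sum]
  simp [movedCard]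

theorem abs_movedCard_sub_le [Finite α] (σ τ : Equiv.Perm α) :
    |((σ.movedCard : ℤ) - τ.movedCard : ℤ)| ≤ ({x | σ x ≠ τ x}.ncard : ℤ) := by
  have key : ∀ σ τ : Equiv.Perm α, σ.movedCard ≤ τ.movedCard + {x | σ x ≠ τ x}.ncard := by
    intro σ τ
    refine (Set.ncard_le_ncard ?_).trans (Set.ncard_union_le _ _)
    intro x hx
    by_cases h : σ x = τ x
    · exact Or.inl fun h' => hx (h.trans h')
    · exact Or.inr h
  have h₁ := key σ τ
  have h₂ := key τ σ
  simp only [ne_comm (a := τ _)] at h₂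
  rw [abs_le]
  omega

/-- Every nontrivial cycle has length exactly `p`, so the size of the support determines the cycle
type. -/
theorem isConj_of_pow_prime_eq_one [Fintype α] [DecidableEq α] {p : ℕ} (hp : p.Prime)
    {σ τ : Equiv.Perm α} (hσ : σ ^ p = 1) (hτ : τ ^ p = 1)
    (h : σ.support.card = τ.support.card) : IsConj σ τ := by
  have key : ∀ σ : Equiv.Perm α, σ ^ p = 1 →
      σ.cycleType = Multiset.replicate (Multiset.card σ.cycleType) p := by
    intro σ hσ
    refine Multiset.eq_replicate.2 ⟨rfl, fun b hb => ?_⟩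
    have h1 := (dvd_of_mem_cycleType hb).trans (orderOf_dvd_of_pow_eq_one hσ)
    have h2 := two_le_of_mem_cycleType hb
    exact ((Nat.dvd_prime hp).1 h1).resolve_left (by omega)
  refine isConj_of_cycleType_eq ?_
  rw [← sum_cycleType, ← sum_cycleType, key σ hσ, key τ hτ, Multiset.sum_replicate,
    Multiset.sum_replicate, smul_eq_mul, smul_eq_mul] at h
  rw [key σ hσ, key τ hτ, Nat.eq_of_mul_eq_mul_right hp.pos h]

/-- The conjugator can be the identity on the points where all powers of `σ` and `τ` agree. This set
is invariant under both permutations, so the remaining parts still move equally many points and are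
conjugate. A remaining point has a disagreement of `σ` and `τ` on its `σ`-orbit, which has at most
`p` points. -/
theorem exists_conj_of_movedCard_eq [Finite α] {p : ℕ} (hp : p.Prime)
    {σ τ : Equiv.Perm α} (hσ : σ ^ p = 1) (hτ : τ ^ p = 1) (h : σ.movedCard = τ.movedCard) :
    ∃ w : Equiv.Perm α, w * σ * w⁻¹ = τ ∧
      {x | w x ≠ x}.ncard ≤ p * {x | σ x ≠ τ x}.ncard := by
  classical
  have := Fintype.ofFinite α
  let A : α → Prop := fun x => ∀ i : ℕ, (σ ^ i) x = (τ ^ i) x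
  have hA : ∀ {x}, A x → ∀ k : ℕ, A ((σ ^ k) x) := by
    intro x hx k i
    rw [← mul_apply, ← pow_add, hx, pow_add, mul_apply, hx]
  have hA1 : ∀ {x}, A x → σ x = τ x := fun hx => by simpa using hx 1
  have hp1 : p - 1 + 1 = p := Nat.sub_add_cancel hp.one_le
  have hAσ : ∀ x, A (σ x) ↔ A x := by
    refine fun x => ⟨fun hx => ?_, fun hx => by simpa using hA hx 1⟩
    -- `σ ^ (p - 1)` is the inverse of `σ`.
    have := hA hx (p - 1)
    rwa [← mul_apply, ← pow_succ, hp1, hσ] at this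
  have hAτ : ∀ x, A (τ x) ↔ A x := by
    refine fun x => ⟨fun hx => ?_, fun hx => by rw [← hA1 hx]; exact (hAσ x).2 hx⟩
    have := hA hx (p - 1)
    rwa [hx (p - 1), ← mul_apply, ← pow_succ, hp1, hτ] at this
  let σ' : Equiv.Perm {x // ¬ A x} := σ.subtypePerm fun x => not_congr (hAσ x)
  let τ' : Equiv.Perm {x // ¬ A x} := τ.subtypePerm fun x => not_congr (hAτ x)
  have hcard : σ'.support.card = τ'.support.card := by
    have key : ∀ (ρ : Equiv.Perm α) (hρ : ∀ x, ¬ A (ρ x) ↔ ¬ A x),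
        (ρ.subtypePerm (p := fun x => ¬ A x) hρ).support.card + (ρ.support.filter A).card =
          ρ.support.card := by
      intro ρ hρ
      rw [← Finset.card_filter_add_card_filter_not (s := ρ.support) A, add_comm,
        ← Finset.card_subtype fun x => ¬ A x]
      congr 2
      ext x
      simp [Subtype.ext_iff]
    have h1 := key σ fun x => not_congr (hAσ x)
    have h2 := key τ fun x => not_congr (hAτ x)
    have h3 : σ.support.filter A = τ.support.filter A := by
      ext x
      simp only [Finset.mem_filter, mem_support]
      exact and_congr_left fun hx => by rw [hA1 hx]
    rw [h3] at h1
    rw [movedCard_eq_card_support, movedCard_eq_card_support] at h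
    change σ'.support.card + _ = _ at h1
    change τ'.support.card + _ = _ at h2
    omega
  obtain ⟨w, hw⟩ := isConj_iff.1 (isConj_of_pow_prime_eq_one hp
    (show σ' ^ p = 1 by ext x; simp [σ', hσ]) (show τ' ^ p = 1 by ext x; simp [τ', hτ]) hcard)
  refine ⟨ofSubtype w, ?_, ?_⟩
  · rw [mul_inv_eq_iff_eq_mul]
    ext x
    rw [mul_apply, mul_apply]
    by_cases hx : A x
    · rw [ofSubtype_apply_of_not_mem (p := fun x => ¬ A x) _ (not_not.2 hx),
        ofSubtype_apply_of_not_mem (p := fun x => ¬ A x) _ (not_not.2 ((hAσ x).2 hx)), hA1 hx]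
    · rw [ofSubtype_apply_of_mem (p := fun x => ¬ A x) _ hx,
        ofSubtype_apply_of_mem (p := fun x => ¬ A x) _ (mt (hAσ x).1 hx)]
      have := congrArg (fun ρ : Equiv.Perm {x // ¬ A x} => (ρ ⟨x, hx⟩ : α))
        (mul_inv_eq_iff_eq_mul.1 hw)
      exact this
  · have hsub : {x | ofSubtype w x ≠ x} ⊆
        ((Finset.range p).biUnion fun i => Finset.univ.filter fun x =>
          σ ((σ ^ i) x) ≠ τ ((σ ^ i) x) : Finset α) := by
      intro x hx
      by_contra hcon
      have hcon' : ∀ i < p, σ ((σ ^ i) x) = τ ((σ ^ i) x) := by simpa using hcon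
      refine hx (ofSubtype_apply_of_not_mem (p := fun x => ¬ A x) _ (not_not.2 fun i => ?_))
      induction i with
      | zero => rfl
      | succ i ih =>
        -- Agreement is known only for exponents below `p`; reduction modulo `p` extends it to all.
        rw [pow_succ', mul_apply, pow_eq_pow_mod i hσ, hcon' _ (Nat.mod_lt _ hp.pos),
          ← pow_eq_pow_mod i hσ, ih, ← mul_apply, ← pow_succ']
    refine (Set.ncard_le_ncard hsub).trans ?_
    rw [Set.ncard_coe_finset]
    refine (Finset.card_biUnion_le_card_mul _ _ {x | σ x ≠ τ x}.ncard fun i _ => ?_).trans_eq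
      (by rw [Finset.card_range])
    rw [← Set.ncard_coe_finset]
    refine le_of_eq ?_
    simpa using Set.ncard_preimage_of_injective_subset_range (s := {x | σ x ≠ τ x})
      (σ ^ i).injective (by simp [(σ ^ i).surjective.range_eq])

end Equiv.Perm

/-! ### Groups with exactly two transitive finite actions -/

namespace TransitiveAction

variable {H : Type*} [Group H]

/-- The trivial action on a point. -/
def trivial (H : Type*) [Group H] : TransitiveAction H where
  space := ⟨Unit⟩
  hom := 1
  transitive _ _ := ⟨1, rfl⟩

/-- The orbit of a point under an action. -/
def orbit {X : FinSet} (ψ : H →* PAut X) (x : X) : TransitiveAction H :=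
  letI := MulAction.compHom X ψ
  have : Nonempty (MulAction.orbit H x) := ⟨⟨x, MulAction.mem_orbit_self x⟩⟩
  { space := ⟨MulAction.orbit H x⟩
    hom := MulAction.toPermHom H (MulAction.orbit H x)
    transitive := fun y z => MulAction.exists_smul_eq H y z }

theorem orbit_hom_ne_one {X : FinSet} (ψ : H →* PAut X) (x : X) {h : H} (hx : ψ h x ≠ x) :
    (orbit ψ x).hom h ≠ 1 := by
  intro hcon
  let := MulAction.compHom X ψ
  exact hx (congrArg Subtype.val (Equiv.congr_fun (α := MulAction.orbit H x)
    (β := MulAction.orbit H x) hcon ⟨x, MulAction.mem_orbit_self x⟩))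

/-- The action on the cosets of a subgroup of a quotient. -/
def coset {Q : Type} [Group Q] [Finite Q] (f : H →* Q) (hf : Function.Surjective f)
    (K : Subgroup Q) : TransitiveAction H where
  space := ⟨Q ⧸ K⟩
  hom := (MulAction.toPermHom Q (Q ⧸ K)).comp f
  transitive x y := by
    obtain ⟨q, hq⟩ := MulAction.exists_smul_eq Q x y
    obtain ⟨h, rfl⟩ := hf q
    exact ⟨h, hq⟩

theorem card_eq {S T : TransitiveAction H} (h : (setoid H).r S T) :
    Nat.card S.space = Nat.card T.space := Nat.card_congr h.choose

theorem hom_ne_one {S T : TransitiveAction H} (h : (setoid H).r S T) {x : H}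
    (hx : S.hom x ≠ 1) : T.hom x ≠ 1 := by
  obtain ⟨e, he⟩ := h
  contrapose! hx
  ext y
  exact e.injective (by rw [he, hx]; rfl)

/-- A residually finite group with exactly two transitive finite actions is cyclic of prime
order. -/
theorem exists_prime_generator
    (hres : ∀ h : H, h ≠ 1 → ∃ (X : FinSet) (ψ : H →* PAut X), ψ h ≠ 1)
    (hrank : Module.rank ℤ (LambdaP H) = 2) :
    ∃ (h₀ : H) (p : ℕ), p.Prime ∧ h₀ ^ p = 1 ∧ h₀ ≠ 1 ∧ ∀ h, h ∈ Subgroup.zpowers h₀ := by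
  obtain ⟨a, hat, ha⟩ := exists_ne_and_forall_eq_or_eq_of_rank_eq_two hrank
    (Quotient.mk (setoid H) (trivial H))
  obtain ⟨S, rfl⟩ := Quotient.exists_rep a
  have hcl : ∀ T : TransitiveAction H, (setoid H).r T (trivial H) ∨ (setoid H).r T S :=
    fun T => (ha (Quotient.mk _ T)).imp Quotient.exact Quotient.exact
  -- A nontrivial element moves a point of some finite action, hence acts nontrivially on its orbit.
  -- That orbit cannot be the one-point action, so it is `S`. Thus `S` is faithful.
  have hinj : Function.Injective S.hom := by
    refine (injective_iff_map_eq_one _).2 fun h => ?_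
    contrapose!
    intro hh
    obtain ⟨X, ψ, hψ⟩ := hres h hh
    obtain ⟨x, hx⟩ : ∃ x, ψ h x ≠ x := by
      by_contra! hcon
      exact hψ (Equiv.ext hcon)
    have hne := orbit_hom_ne_one ψ x hx
    rcases hcl (orbit ψ x) with hT | hT
    · exact absurd rfl (hom_ne_one hT hne)
    · exact hom_ne_one hT hne
  have hQ : Nat.card S.hom.range ≠ 1 := by
    intro h1
    have : Subsingleton S.hom.range := (Nat.card_eq_one_iff_unique.1 h1).1
    have hS : ∀ h, S.hom h = 1 := fun h =>
      congrArg Subtype.val (Subsingleton.elim (⟨S.hom h, h, rfl⟩ : S.hom.range) 1)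
    have : Subsingleton S.space := ⟨fun x y => by
      obtain ⟨g, hg⟩ := S.transitive x y
      rwa [hS] at hg⟩
    have : Unique S.space := uniqueOfSubsingleton (Classical.arbitrary _)
    exact hat (Quotient.sound ⟨Equiv.ofUnique S.space Unit, fun _ _ => rfl⟩)
  obtain ⟨p, hp, hpd⟩ := Nat.exists_prime_and_dvd hQ
  have := Fact.mk hp
  obtain ⟨⟨_, h₀, rfl⟩, hq⟩ := exists_prime_orderOf_dvd_card' p hpd
  have hsurj := S.hom.rangeRestrict_surjective
  have horder : orderOf h₀ = p := by
    rw [← hq, ← orderOf_injective S.hom hinj, ← Subgroup.orderOf_coe]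
  refine ⟨h₀, p, hp, horder ▸ pow_orderOf_eq_one h₀, ?_, fun h => ?_⟩
  · rintro rfl
    rw [orderOf_one] at horder
    exact hp.one_lt.ne horder
  let q : S.hom.range := S.hom.rangeRestrict h₀
  have hcard := Subgroup.card_eq_card_quotient_mul_card_subgroup (Subgroup.zpowers q)
  rw [Nat.card_zpowers, show orderOf q = p from hq] at hcard
  have hbot : Nat.card (coset S.hom.rangeRestrict hsurj ⊥).space = Nat.card S.hom.range :=
    Nat.card_congr QuotientGroup.quotientBot.toEquiv
  have hone : Nat.card (trivial H).space = 1 := Nat.card_unique (α := Unit)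
  -- The regular action of the image has more than one point, so it is `S`.
  have hreg : (setoid H).r (coset S.hom.rangeRestrict hsurj ⊥) S :=
    (hcl _).resolve_left fun hT => hQ (by rw [← hbot, card_eq hT, hone])
  have hpos : 0 < Nat.card S.hom.range := Nat.card_pos
  -- The cosets of a subgroup of prime order, supplied by Cauchy's theorem, form either one point,
  -- so that `q` generates, or a copy of the regular action, which Lagrange's theorem forbids.
  rcases hcl (coset S.hom.rangeRestrict hsurj (Subgroup.zpowers q)) with hT | hT
  · have h1 : Nat.card (S.hom.range ⧸ Subgroup.zpowers q) = 1 := (card_eq hT).trans hone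
    have htop : Subgroup.zpowers q = ⊤ := Subgroup.index_eq_one.1 h1
    have hmem : S.hom.rangeRestrict h ∈ Subgroup.zpowers q := htop ▸ Subgroup.mem_top _
    obtain ⟨k, hk⟩ := Subgroup.mem_zpowers_iff.1 hmem
    refine Subgroup.mem_zpowers_iff.2 ⟨k, hinj ?_⟩
    rw [map_zpow]
    exact congrArg Subtype.val hk
  · have h1 : Nat.card (S.hom.range ⧸ Subgroup.zpowers q) = Nat.card S.hom.range :=
      (card_eq hT).trans ((card_eq hreg).symm.trans hbot)
    rw [h1] at hcard
    have := hp.one_lt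
    nlinarith

end TransitiveAction

/-! ### Disjoint unions and the theorem for permutations -/

/-- The disjoint union of a nonempty finite set and a finite set. -/
def FinSet.sum (X : FinSet) (K : Type) [Finite K] : FinSet := ⟨X ⊕ K⟩

theorem FinSet.card_sum (X : FinSet) (K : Type) [Finite K] :
    Nat.card (X.sum K) = Nat.card X + Nat.card K := Nat.card_sum

theorem FinSet.card_pos (X : FinSet) : (0 : ℝ) < Nat.card X := by exact_mod_cast Nat.card_pos

/-- The disjoint union of permutations. -/
def PAut.sum {X : FinSet} {K : Type} [Finite K] (a : PAut X) (b : Equiv.Perm K) :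
    PAut (X.sum K) := Equiv.Perm.sumCongr a b

/-- The disjoint union of two actions. -/
def PAut.sumHom {G : Type*} [Group G] {X : FinSet} {K : Type} [Finite K] (f : G →* PAut X)
    (g : G →* Equiv.Perm K) : G →* PAut (X.sum K) :=
  (Equiv.Perm.sumCongrHom X K).comp (f.prod g)

theorem PAut.sum_mul {X : FinSet} {K : Type} [Finite K] (a a' : PAut X) (b b' : Equiv.Perm K) :
    PAut.sum a b * PAut.sum a' b' = PAut.sum (a * a') (b * b') :=
  Equiv.Perm.sumCongr_mul _ _ _ _

/-- At worst every point of `K` is a disagreement, so the action placed on a small summand is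
irrelevant in the limit. -/
theorem hammDist_sum_le {X : FinSet} {K : Type} [Finite K] (a a' : PAut X)
    (b b' : Equiv.Perm K) :
    hammDist (X.sum K) (a.sum b) (a'.sum b') ≤
      hammDist X a a' + (Nat.card K : ℝ) / Nat.card X := by
  have hX := X.card_pos
  have hset : {y : X.sum K | a.sum b y ≠ a'.sum b' y}.ncard ≤
      {x | a x ≠ a' x}.ncard + Nat.card K := by
    refine (Equiv.Perm.ncard_sum (α := X) (β := K) _).trans_le ?_
    refine add_le_add (le_of_eq ?_) (Set.ncard_le_card _)
    congr 1
    ext x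
    exact not_congr Sum.inl_injective.eq_iff
  unfold hammDist
  rw [← add_div, FinSet.card_sum]
  push_cast
  refine div_le_div₀ (by positivity) (by exact_mod_cast hset) hX (by simp)

theorem hammDist_sum_one {X : FinSet} {K : Type} [Finite K] (a a' : PAut X) :
    hammDist (X.sum K) (a.sum 1) (a'.sum 1) ≤ hammDist X a a' := by
  have hX := X.card_pos
  have hset : {y : X.sum K | a.sum (1 : Equiv.Perm K) y ≠ a'.sum (1 : Equiv.Perm K) y}.ncard =
      {x | a x ≠ a' x}.ncard := by
    have h1 : (Sum.inr ⁻¹' {y : X.sum K | a.sum (1 : Equiv.Perm K) y ≠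
        a'.sum (1 : Equiv.Perm K) y} : Set K) = ∅ := by
      ext x
      exact iff_of_false (fun h => h rfl) id
    refine (Equiv.Perm.ncard_sum (α := X) (β := K) _).trans ((congrArg₂ (· + ·) ?_
      ((congrArg Set.ncard h1).trans (Set.ncard_empty _))).trans (add_zero _))
    congr 1
    ext x
    exact not_congr Sum.inl_injective.eq_iff
  unfold hammDist
  rw [hset, FinSet.card_sum]
  push_cast
  gcongr
  simp

theorem ncard_inl_ne_div_le {X : FinSet} {K : Type} [Finite K] (a : PAut X)
    (b : PAut (X.sum K)) :
    ({x : X | (Sum.inl (a x) : X ⊕ K) ≠ b (Sum.inl x : X ⊕ K)}.ncard : ℝ) / Nat.card X ≤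
      hammDist (X.sum K) (a.sum 1) b * (Nat.card (X.sum K) / Nat.card X) := by
  have hX := X.card_pos
  have hY := (X.sum K).card_pos
  unfold hammDist
  rw [div_mul_div_cancel₀ hY.ne']
  gcongr
  exact Nat.le_of_add_right_le (Equiv.Perm.ncard_sum (α := X) (β := K)
    {y : X.sum K | a.sum (1 : Equiv.Perm K) y ≠ b y}).ge

/-- The differences of the numbers of points moved by `g₁` and `g₂` in actions of two groups on
the same finite set, together with the size of this set. -/
def movedDiff {G₁ G₂ : Type*} [Group G₁] [Group G₂] (g₁ : G₁) (g₂ : G₂) :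
    AddSubmonoid (ℤ × ℕ) where
  carrier := {x | ∃ (K : Type) (_ : Finite K) (f₁ : G₁ →* Equiv.Perm K)
    (f₂ : G₂ →* Equiv.Perm K),
      x = (((f₁ g₁).movedCard : ℤ) - (f₂ g₂).movedCard, Nat.card K)}
  zero_mem' := ⟨Empty, inferInstance, 1, 1, by simp; rfl⟩
  add_mem' := by
    rintro _ _ ⟨K, _, f₁, f₂, rfl⟩ ⟨L, _, f₁', f₂', rfl⟩
    refine ⟨K ⊕ L, inferInstance, (Equiv.Perm.sumCongrHom K L).comp (f₁.prod f₁'),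
      (Equiv.Perm.sumCongrHom K L).comp (f₂.prod f₂'), ?_⟩
    simp only [MonoidHom.comp_apply, MonoidHom.prod_apply, Equiv.Perm.sumCongrHom_apply,
      Equiv.Perm.movedCard_sumCongr, Nat.card_sum, Prod.mk_add_mk]
    push_cast
    ring_nf

theorem isFlexiblyPStable_amalgamatedProduct {G₁ G₂ H : Type*} [Group G₁] [Group G₂] [Group H]
    [Group.FG G₁] [Group.FG G₂] (i₁ : H →* G₁) (i₂ : H →* G₂)
    (hi₁ : Function.Injective i₁) (hi₂ : Function.Injective i₂)
    (ha₁ : IsPApproximated G₁) (ha₂ : IsPApproximated G₂) (hs₁ : IsPStable G₁)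
    (hs₂ : IsPStable G₂) (hrank : Module.rank ℤ (LambdaP H) = 2) :
    IsFlexiblyPStable (AmalgamatedProduct i₁ i₂) := by
  have hd := isBiinvariantDist_hammDist
  have := Group.FG.countable G₁
  have := Group.FG.countable G₂
  have hr₁ := fun h (hh : h ≠ 1) => hd.exists_hom_ne_one ha₁ hs₁ ((map_ne_one_iff i₁ hi₁).2 hh)
  have hr₂ := fun h (hh : h ≠ 1) => hd.exists_hom_ne_one ha₂ hs₂ ((map_ne_one_iff i₂ hi₂).2 hh)
  obtain ⟨h₀, p, hp, hpow, hne, hgen⟩ := TransitiveAction.exists_prime_generator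
    (fun h hh => let ⟨X, ψ, hψ⟩ := hr₁ h hh; ⟨X, ψ.comp i₁, hψ⟩) hrank
  obtain ⟨K₁, κ₁, hκ₁⟩ := hr₁ h₀ hne
  obtain ⟨K₂, κ₂, hκ₂⟩ := hr₂ h₀ hne
  let R := movedDiff (i₁ h₀) (i₂ h₀)
  -- A separating action of one factor paired with the trivial action of the other gives a
  -- difference of either sign.
  obtain ⟨C, hC0, hC⟩ := R.exists_neg_fst_mem ⟨K₁, inferInstance, κ₁, 1, rfl⟩
    (by simpa using Equiv.Perm.movedCard_pos hκ₁) ⟨K₂, inferInstance, 1, κ₂, rfl⟩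
    (by simpa using Equiv.Perm.movedCard_pos hκ₂)
  intro X φ hφ
  obtain ⟨ψ₁, hψ₁⟩ := hs₁ X (fun n g => φ n (AmalgamatedProduct.inl i₁ i₂ g))
    fun a b => by simpa only [map_mul] using hφ (AmalgamatedProduct.inl i₁ i₂ a) _
  obtain ⟨ψ₂, hψ₂⟩ := hs₂ X (fun n g => φ n (AmalgamatedProduct.inr i₁ i₂ g))
    fun a b => by simpa only [map_mul] using hφ (AmalgamatedProduct.inr i₁ i₂ a) _
  have hUV : Tendsto (fun n => hammDist (X n) (ψ₁ n (i₁ h₀)) (ψ₂ n (i₂ h₀))) atTop (𝓝 0) := by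
    have hlim := (hψ₁ (i₁ h₀)).add (hψ₂ (i₂ h₀))
    rw [add_zero] at hlim
    refine squeeze_zero (fun n => hd.nonneg _ _ _) (fun n => ?_) hlim
    refine (hd.triangle _ _ _ _).trans (add_le_add (hd.comm _ _ _).le (le_of_eq ?_))
    rw [AmalgamatedProduct.inl_eq_inr]
  -- The set `X n` with `ψ₁ n`, `ψ₂ n` itself witnesses that the difference to be cancelled lies in
  -- `R`.
  choose k hkR hk using fun n => hC _ ⟨X n, inferInstance, ψ₁ n, ψ₂ n, rfl⟩
  choose K hfin f₁ f₂ hf using hkR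
  have hkR0 : Tendsto (fun n => (Nat.card (K n) : ℝ) / Nat.card (X n)) atTop (𝓝 0) := by
    have hlim := hUV.const_mul C
    rw [mul_zero] at hlim
    refine squeeze_zero (fun n => by positivity) (fun n => ?_) hlim
    have hX := (X n).card_pos
    have hkn : k n = Nat.card (K n) := congrArg Prod.snd (hf n)
    rw [hammDist, ← mul_div_assoc, ← hkn]
    gcongr
    refine (hk n).trans ?_
    gcongr
    exact_mod_cast Equiv.Perm.abs_movedCard_sub_le (ψ₁ n (i₁ h₀)) (ψ₂ n (i₂ h₀))
  let Y : ℕ → FinSet := fun n => (X n).sum (K n)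
  let χ₁ : ∀ n, G₁ →* PAut (Y n) := fun n => PAut.sumHom (ψ₁ n) (f₁ n)
  let χ₂ : ∀ n, G₂ →* PAut (Y n) := fun n => PAut.sumHom (ψ₂ n) (f₂ n)
  have hpow₁ : ∀ n, χ₁ n (i₁ h₀) ^ p = 1 := fun n => by
    rw [← map_pow, ← map_pow, hpow, map_one, map_one]
  have hpow₂ : ∀ n, χ₂ n (i₂ h₀) ^ p = 1 := fun n => by
    rw [← map_pow, ← map_pow, hpow, map_one, map_one]
  have hmoved : ∀ n, (χ₁ n (i₁ h₀)).movedCard = (χ₂ n (i₂ h₀)).movedCard := fun n => by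
    have h1 := congrArg Prod.fst (hf n)
    have h2 := Equiv.Perm.movedCard_sumCongr (ψ₁ n (i₁ h₀)) (f₁ n (i₁ h₀))
    have h3 := Equiv.Perm.movedCard_sumCongr (ψ₂ n (i₂ h₀)) (f₂ n (i₂ h₀))
    refine h2.trans (Eq.trans ?_ h3.symm)
    dsimp only at h1
    omega
  choose W hW hWle using fun n =>
    Equiv.Perm.exists_conj_of_movedCard_eq hp (hpow₁ n) (hpow₂ n) (hmoved n)
  have hclose : ∀ {a b : ∀ n, PAut (X n)} (c e : ∀ n, Equiv.Perm (K n)),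
      Tendsto (fun n => hammDist (X n) (a n) (b n)) atTop (𝓝 0) →
      Tendsto (fun n => hammDist (Y n) ((a n).sum (c n)) ((b n).sum (e n))) atTop (𝓝 0) := by
    intro a b c e h
    have hlim := h.add hkR0
    rw [add_zero] at hlim
    exact squeeze_zero (fun n => hd.nonneg _ _ _) (fun n => hammDist_sum_le _ _ _ _) hlim
  -- The given maps are extended by the identity on `K n`, which keeps them asymptotically
  -- multiplicative.
  obtain ⟨ψ, hψ⟩ := hd.exists_amalgam_hom (Y := Y) (φ := fun n a => (φ n a).sum 1)
    (fun a b => squeeze_zero (fun n => hd.nonneg _ _ _)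
      (fun n => by rw [PAut.sum_mul, one_mul]; exact hammDist_sum_one _ _) (hφ a b))
    χ₁ χ₂ W (fun g => hclose _ _ (hψ₁ g)) (fun g => hclose _ _ (hψ₂ g))
    (by
      have hlim := (hclose (fun n => f₁ n (i₁ h₀)) (fun n => f₂ n (i₂ h₀)) hUV).const_mul (p : ℝ)
      rw [mul_zero] at hlim
      refine squeeze_zero (fun n => hd.nonneg _ _ _) (fun n => ?_) hlim
      unfold hammDist
      rw [← mul_div_assoc]
      gcongr
      exact_mod_cast hWle n)
    (fun n => MonoidHom.conj_eq_of_forall_mem_zpowers (f₁ := (χ₁ n).comp i₁)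
      (f₂ := (χ₂ n).comp i₂) hgen (hW n))
  have hratio : Tendsto (fun n => (Nat.card (Y n) : ℝ) / Nat.card (X n)) atTop (𝓝 1) := by
    have hlim := hkR0.const_add 1
    rw [add_zero] at hlim
    refine hlim.congr fun n => ?_
    have hX := (X n).card_pos
    rw [FinSet.card_sum]
    push_cast
    rw [add_div, div_self hX.ne']
  refine ⟨Y, fun n => ⟨Sum.inl, Sum.inl_injective⟩, ψ, fun a => ?_, hratio⟩
  -- The factor `|Y n| / |X n|` accounts for normalizing by `X n` instead of `Y n`.
  have hlim := (hψ a).mul hratio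
  rw [zero_mul] at hlim
  exact squeeze_zero (fun n => by positivity) (fun n => ncard_inl_ne_div_le _ _) hlim

/-! ### Frobenius norms, direct sums and traces of involutions -/

section Frobenius

variable {V K : Type*} [NormedAddCommGroup V] [InnerProductSpace ℂ V]
  [NormedAddCommGroup K] [InnerProductSpace ℂ K] {ι : Type*} [Fintype ι]

/-- The direct sum of two unitary operators. -/
noncomputable def unitarySum (a : V ≃ₗᵢ[ℂ] V) (b : K ≃ₗᵢ[ℂ] K) :
    WithLp 2 (V × K) ≃ₗᵢ[ℂ] WithLp 2 (V × K) :=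
  LinearIsometryEquiv.withLpProdCongr 2 a b

theorem unitarySum_mul (a a' : V ≃ₗᵢ[ℂ] V) (b b' : K ≃ₗᵢ[ℂ] K) :
    unitarySum a b * unitarySum a' b' = unitarySum (a * a') (b * b') := rfl

/-- The direct sum of two unitary representations. -/
noncomputable def unitarySumHom {G : Type*} [Group G] (f : G →* (V ≃ₗᵢ[ℂ] V))
    (g : G →* (K ≃ₗᵢ[ℂ] K)) : G →* (WithLp 2 (V × K) ≃ₗᵢ[ℂ] WithLp 2 (V × K)) where
  toFun x := unitarySum (f x) (g x)
  map_one' := by rw [map_one, map_one]; rfl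
  map_mul' x y := by rw [map_mul, map_mul, unitarySum_mul]

variable (V K) in
/-- The isometric inclusion of the first summand. -/
noncomputable def l2Inl : V →ₗᵢ[ℂ] WithLp 2 (V × K) where
  toLinearMap := ((WithLp.linearEquiv 2 ℂ (V × K)).symm : V × K →ₗ[ℂ] WithLp 2 (V × K)) ∘ₗ
    LinearMap.inl ℂ V K
  norm_map' x := WithLp.norm_toLp_fst 2 V K x

/-- The dimension of the eigenspace of a unitary operator for the eigenvalue `-1`. -/
noncomputable def negDim (a : V ≃ₗᵢ[ℂ] V) : ℕ :=
  Module.finrank ℂ (LinearMap.ker ((a.toLinearEquiv : V →ₗ[ℂ] V) + LinearMap.id))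

theorem mem_ker_add_id_iff (a : V ≃ₗᵢ[ℂ] V) (x : V) :
    x ∈ LinearMap.ker ((a.toLinearEquiv : V →ₗ[ℂ] V) + LinearMap.id) ↔ a x = -x := by
  rw [LinearMap.mem_ker]
  exact add_eq_zero_iff_eq_neg

theorem apply_apply_of_sq_eq_one {a : V ≃ₗᵢ[ℂ] V} (ha : a ^ 2 = 1) (x : V) : a (a x) = x := by
  rw [sq] at ha
  exact DFunLike.congr_fun ha x

variable [FiniteDimensional ℂ V] [FiniteDimensional ℂ K]

/-- The square of the Frobenius norm of an operator. -/
noncomputable def frobSq (A : V →ₗ[ℂ] V) : ℝ :=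
  (LinearMap.trace ℂ V (LinearMap.adjoint A ∘ₗ A)).re

theorem frobSq_eq_sum (A : V →ₗ[ℂ] V) (b : OrthonormalBasis ι ℂ V) :
    frobSq A = ∑ i, ‖A (b i)‖ ^ 2 := by
  rw [frobSq, LinearMap.trace_eq_sum_inner _ b, Complex.re_sum]
  refine Finset.sum_congr rfl fun i _ => ?_
  rw [LinearMap.comp_apply, LinearMap.adjoint_inner_right]
  exact inner_self_eq_norm_sq (𝕜 := ℂ) _

theorem frobSq_nonneg (A : V →ₗ[ℂ] V) : 0 ≤ frobSq A := by
  rw [frobSq_eq_sum A (stdOrthonormalBasis ℂ V)]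
  positivity

/-- The square of the Frobenius distance of two unitary operators. -/
noncomputable def unitaryDistSq (a b : V ≃ₗᵢ[ℂ] V) : ℝ :=
  frobSq ((a.toLinearEquiv : V →ₗ[ℂ] V) - (b.toLinearEquiv : V →ₗ[ℂ] V))

theorem unitaryDistSq_eq_sum (a b : V ≃ₗᵢ[ℂ] V) (e : OrthonormalBasis ι ℂ V) :
    unitaryDistSq a b = ∑ i, ‖a (e i) - b (e i)‖ ^ 2 :=
  frobSq_eq_sum _ e

theorem unitaryDistSq_nonneg (a b : V ≃ₗᵢ[ℂ] V) : 0 ≤ unitaryDistSq a b := frobSq_nonneg _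

theorem unitaryDistSq_le (a b : V ≃ₗᵢ[ℂ] V) :
    unitaryDistSq a b ≤ 4 * Module.finrank ℂ V := by
  rw [unitaryDistSq_eq_sum a b (stdOrthonormalBasis ℂ V)]
  refine (Finset.sum_le_card_nsmul _ _ 4 fun i _ => ?_).trans_eq (by simp [mul_comm])
  have h := norm_sub_le (a (stdOrthonormalBasis ℂ V i)) (b (stdOrthonormalBasis ℂ V i))
  simp only [LinearIsometryEquiv.norm_map, OrthonormalBasis.norm_eq_one] at h
  nlinarith [norm_nonneg (a (stdOrthonormalBasis ℂ V i) - b (stdOrthonormalBasis ℂ V i))]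

theorem unitaryDistSq_unitarySum (a a' : V ≃ₗᵢ[ℂ] V) (b b' : K ≃ₗᵢ[ℂ] K) :
    unitaryDistSq (unitarySum a b) (unitarySum a' b') =
      unitaryDistSq a a' + unitaryDistSq b b' := by
  rw [unitaryDistSq_eq_sum a a' (stdOrthonormalBasis ℂ V),
    unitaryDistSq_eq_sum b b' (stdOrthonormalBasis ℂ K),
    unitaryDistSq_eq_sum _ _ ((stdOrthonormalBasis ℂ V).prod (stdOrthonormalBasis ℂ K)),
    Fintype.sum_sum_type]
  congr 1
  · refine Finset.sum_congr rfl fun i _ => ?_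
    rw [WithLp.prod_norm_sq_eq_of_L2]
    simp [unitarySum]
  · refine Finset.sum_congr rfl fun i _ => ?_
    rw [WithLp.prod_norm_sq_eq_of_L2]
    simp [unitarySum]

theorem trace_unitarySum (a : V ≃ₗᵢ[ℂ] V) (b : K ≃ₗᵢ[ℂ] K) :
    LinearMap.trace ℂ _ ((unitarySum a b).toLinearEquiv : WithLp 2 (V × K) →ₗ[ℂ] _) =
      LinearMap.trace ℂ V (a.toLinearEquiv : V →ₗ[ℂ] V) +
        LinearMap.trace ℂ K (b.toLinearEquiv : K →ₗ[ℂ] K) := by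
  rw [LinearMap.trace_eq_sum_inner _ (stdOrthonormalBasis ℂ V),
    LinearMap.trace_eq_sum_inner _ (stdOrthonormalBasis ℂ K),
    LinearMap.trace_eq_sum_inner _
      ((stdOrthonormalBasis ℂ V).prod (stdOrthonormalBasis ℂ K)), Fintype.sum_sum_type]
  congr 1
  · refine Finset.sum_congr rfl fun i _ => ?_
    rw [WithLp.prod_inner_apply]
    simp [unitarySum]
  · refine Finset.sum_congr rfl fun i _ => ?_
    rw [WithLp.prod_inner_apply]
    simp [unitarySum]

/-- The operator `(1 - a) / 2` is a projection onto the `-1`-eigenspace, so its trace is the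
dimension of that eigenspace. -/
theorem trace_eq_of_sq_eq_one {a : V ≃ₗᵢ[ℂ] V} (ha : a ^ 2 = 1) :
    LinearMap.trace ℂ V (a.toLinearEquiv : V →ₗ[ℂ] V) =
      Module.finrank ℂ V - 2 * (negDim a : ℂ) := by
  let P : V →ₗ[ℂ] V := (1 / 2 : ℂ) • (LinearMap.id - (a.toLinearEquiv : V →ₗ[ℂ] V))
  have hP : ∀ x, P x = (1 / 2 : ℂ) • (x - a x) := fun _ => rfl
  have hproj : LinearMap.IsProj
      (LinearMap.ker ((a.toLinearEquiv : V →ₗ[ℂ] V) + LinearMap.id)) P := by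
    constructor
    · intro x
      rw [mem_ker_add_id_iff, hP, map_smul, map_sub, apply_apply_of_sq_eq_one ha, ← smul_neg,
        neg_sub]
    · intro x hx
      rw [mem_ker_add_id_iff] at hx
      rw [hP, hx, sub_neg_eq_add, ← two_smul ℂ x, smul_smul]
      norm_num
  have h := hproj.trace
  rw [map_smul, map_sub, LinearMap.trace_id, smul_eq_mul] at h
  rw [negDim, ← h]
  ring

theorem negDim_unitarySum {a : V ≃ₗᵢ[ℂ] V} {b : K ≃ₗᵢ[ℂ] K} (ha : a ^ 2 = 1) (hb : b ^ 2 = 1) :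
    negDim (unitarySum a b) = negDim a + negDim b := by
  have hab : unitarySum a b ^ 2 = 1 := by
    rw [sq, unitarySum_mul, ← sq, ← sq, ha, hb]
    rfl
  have h := trace_unitarySum a b
  have hdim : Module.finrank ℂ (WithLp 2 (V × K)) = Module.finrank ℂ V + Module.finrank ℂ K := by
    rw [(WithLp.linearEquiv 2 ℂ (V × K)).finrank_eq, Module.finrank_prod]
  rw [trace_eq_of_sq_eq_one ha, trace_eq_of_sq_eq_one hb, trace_eq_of_sq_eq_one hab, hdim] at h
  push_cast at h
  have h' : (negDim (unitarySum a b) : ℂ) = negDim a + negDim b := by linear_combination -h / 2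
  exact_mod_cast h'

theorem negDim_one : negDim (1 : V ≃ₗᵢ[ℂ] V) = 0 := by
  have h := trace_eq_of_sq_eq_one (one_pow 2 : (1 : V ≃ₗᵢ[ℂ] V) ^ 2 = 1)
  change LinearMap.trace ℂ V LinearMap.id = _ at h
  rw [LinearMap.trace_id] at h
  have h' : (negDim (1 : V ≃ₗᵢ[ℂ] V) : ℂ) = 0 := by linear_combination h / 2
  exact_mod_cast h'

theorem negDim_pos {a : V ≃ₗᵢ[ℂ] V} (ha : a ^ 2 = 1) (hne : a ≠ 1) : 0 < negDim a := by
  rw [Nat.pos_iff_ne_zero]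
  intro h0
  refine hne (LinearIsometryEquiv.ext fun x => ?_)
  have hbot := Submodule.finrank_eq_zero.1 h0
  have hx : x - a x ∈ LinearMap.ker ((a.toLinearEquiv : V →ₗ[ℂ] V) + LinearMap.id) := by
    rw [mem_ker_add_id_iff, map_sub, apply_apply_of_sq_eq_one ha, neg_sub]
  rw [hbot, Submodule.mem_bot, sub_eq_zero] at hx
  exact hx.symm

/-- Twice the difference is, up to sign, the trace of `a - b`; Cauchy–Schwarz over an orthonormal
basis bounds that trace by the Frobenius distance. -/
theorem abs_negDim_sub_le {a b : V ≃ₗᵢ[ℂ] V} (ha : a ^ 2 = 1) (hb : b ^ 2 = 1) :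
    |(negDim a : ℝ) - negDim b| ≤ Real.sqrt (Module.finrank ℂ V * unitaryDistSq a b) := by
  let e := stdOrthonormalBasis ℂ V
  have h : (2 : ℂ) * ((negDim b : ℂ) - negDim a) = ∑ i, inner ℂ (e i) (a (e i) - b (e i)) := by
    have h1 := LinearMap.trace_eq_sum_inner
      ((a.toLinearEquiv : V →ₗ[ℂ] V) - (b.toLinearEquiv : V →ₗ[ℂ] V)) e
    rw [map_sub, trace_eq_of_sq_eq_one ha, trace_eq_of_sq_eq_one hb] at h1
    refine Eq.trans ?_ h1
    ring
  have h2 : 2 * |(negDim a : ℝ) - negDim b| ≤ ∑ i, ‖a (e i) - b (e i)‖ := by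
    have h3 : ‖(2 : ℂ) * ((negDim b : ℂ) - negDim a)‖ = 2 * |(negDim a : ℝ) - negDim b| := by
      rw [norm_mul, abs_sub_comm, ← Real.norm_eq_abs, ← Complex.norm_real]
      simp
    rw [← h3, h]
    refine (norm_sum_le _ _).trans (Finset.sum_le_sum fun i _ => ?_)
    refine (norm_inner_le_norm (𝕜 := ℂ) (e i) (a (e i) - b (e i))).trans_eq ?_
    rw [e.norm_eq_one, one_mul]
  have h4 := sq_sum_le_card_mul_sum_sq (s := Finset.univ) (f := fun i => ‖a (e i) - b (e i)‖)
  rw [← unitaryDistSq_eq_sum a b e, Finset.card_univ, Fintype.card_fin] at h4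
  refine Real.le_sqrt_of_sq_le (le_trans ?_ h4)
  have := abs_nonneg ((negDim a : ℝ) - negDim b)
  exact pow_le_pow_left₀ this (by linarith) 2

theorem prod_stdOrthonormalBasis_inl (i : Fin (Module.finrank ℂ V)) :
    (stdOrthonormalBasis ℂ V).prod (stdOrthonormalBasis ℂ K) (Sum.inl i) =
      l2Inl V K (stdOrthonormalBasis ℂ V i) := by
  rw [OrthonormalBasis.prod_apply]
  rfl

theorem adjoint_l2Inl (y : WithLp 2 (V × K)) :
    LinearMap.adjoint (l2Inl V K).toLinearMap y = y.fst := by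
  refine ext_inner_right ℂ fun x => ?_
  rw [LinearMap.adjoint_inner_left, WithLp.prod_inner_apply]
  simp [l2Inl]

/-- Compressing discards the basis vectors of `K` and the `K`-components of the images, both of
which only add to the right side. -/
theorem frobSq_sub_compression_le (a : V ≃ₗᵢ[ℂ] V)
    (b : WithLp 2 (V × K) ≃ₗᵢ[ℂ] WithLp 2 (V × K)) :
    frobSq ((a.toLinearEquiv : V →ₗ[ℂ] V) - LinearMap.adjoint (l2Inl V K).toLinearMap ∘ₗ
      (b.toLinearEquiv : WithLp 2 (V × K) →ₗ[ℂ] _) ∘ₗ (l2Inl V K).toLinearMap) ≤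
      unitaryDistSq (unitarySum a 1) b := by
  rw [frobSq_eq_sum _ (stdOrthonormalBasis ℂ V), unitaryDistSq_eq_sum _ _
    ((stdOrthonormalBasis ℂ V).prod (stdOrthonormalBasis ℂ K)), Fintype.sum_sum_type]
  refine le_add_of_le_of_nonneg (Finset.sum_le_sum fun i _ => ?_) (by positivity)
  rw [prod_stdOrthonormalBasis_inl, LinearMap.sub_apply, LinearMap.comp_apply, adjoint_l2Inl]
  exact pow_le_pow_left₀ (norm_nonneg _) (WithLp.norm_fst_le _
    (unitarySum a 1 (l2Inl V K (stdOrthonormalBasis ℂ V i)) -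
      b (l2Inl V K (stdOrthonormalBasis ℂ V i)))) 2

end Frobenius

/-! ### The normalized Hilbert–Schmidt distance -/

theorem hsNorm_eq (X : FDHilb) (A : X →ₗ[ℂ] X) :
    hsNorm X A = Real.sqrt (frobSq A / Module.finrank ℂ X) := rfl

theorem hsDist_eq (X : FDHilb) (a b : UAut X) :
    hsDist X a b = Real.sqrt (unitaryDistSq a b / Module.finrank ℂ X) := rfl

theorem FDHilb.finrank_pos (X : FDHilb) : (0 : ℝ) < Module.finrank ℂ X := by
  exact_mod_cast Module.finrank_pos

/-- Seen as an `ℓ²` norm of the tuple of images of a basis, the Frobenius norm inherits its triangle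
inequality. -/
theorem frobSq_eq_norm_sq {V : Type*} [NormedAddCommGroup V] [InnerProductSpace ℂ V]
    [FiniteDimensional ℂ V] (A : V →ₗ[ℂ] V) :
    Real.sqrt (frobSq A) = ‖(WithLp.toLp 2 fun i => A (stdOrthonormalBasis ℂ V i) :
      PiLp 2 fun _ : Fin (Module.finrank ℂ V) => V)‖ := by
  rw [frobSq_eq_sum A (stdOrthonormalBasis ℂ V), PiLp.norm_eq_of_L2]

theorem sqrt_frobSq_add_le {V : Type*} [NormedAddCommGroup V] [InnerProductSpace ℂ V]
    [FiniteDimensional ℂ V] (A B : V →ₗ[ℂ] V) :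
    Real.sqrt (frobSq (A + B)) ≤ Real.sqrt (frobSq A) + Real.sqrt (frobSq B) := by
  simp only [frobSq_eq_norm_sq]
  exact norm_add_le (WithLp.toLp 2 fun i => A (stdOrthonormalBasis ℂ V i) :
    PiLp 2 fun _ : Fin (Module.finrank ℂ V) => V) (WithLp.toLp 2 fun i => B _)

theorem isBiinvariantDist_hsDist : IsBiinvariantDist UAut hsDist where
  self X a := by
    rw [hsDist_eq, unitaryDistSq_eq_sum a a (stdOrthonormalBasis ℂ X)]
    simp
  nonneg X a b := Real.sqrt_nonneg _
  comm X a b := by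
    rw [hsDist_eq, hsDist_eq, unitaryDistSq_eq_sum a b (stdOrthonormalBasis ℂ X),
      unitaryDistSq_eq_sum b a (stdOrthonormalBasis ℂ X)]
    simp only [norm_sub_rev]
  triangle X a b c := by
    simp only [hsDist, hsNorm_eq, Real.sqrt_div (frobSq_nonneg _)]
    rw [← add_div]
    gcongr
    rw [← sub_add_sub_cancel a.lin b.lin c.lin]
    exact sqrt_frobSq_add_le _ _
  mul_left X a b c := by
    rw [hsDist_eq, hsDist_eq, unitaryDistSq_eq_sum a b (stdOrthonormalBasis ℂ X),
      unitaryDistSq_eq_sum _ _ (stdOrthonormalBasis ℂ X)]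
    simp only [LinearIsometryEquiv.coe_mul, Function.comp_apply, ← map_sub,
      LinearIsometryEquiv.norm_map]
  mul_right X a b c := by
    -- The Frobenius norm does not depend on the orthonormal basis, and `c` carries one such basis
    -- to another.
    rw [hsDist_eq, hsDist_eq, unitaryDistSq_eq_sum a b ((stdOrthonormalBasis ℂ X).map c),
      unitaryDistSq_eq_sum _ _ (stdOrthonormalBasis ℂ X)]
    rfl

/-- The direct sum of a nonzero and an arbitrary finite-dimensional Hilbert space. -/
noncomputable def FDHilb.sum (X : FDHilb) (K : Type) [NormedAddCommGroup K] [InnerProductSpace ℂ K]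
    [FiniteDimensional ℂ K] : FDHilb where
  carrier := WithLp 2 (X × K)
  nontriv := (WithLp.equiv 2 (X × K)).nontrivial

section HSSum

variable {X : FDHilb} {K : Type} [NormedAddCommGroup K] [InnerProductSpace ℂ K]
  [FiniteDimensional ℂ K]

theorem FDHilb.finrank_sum :
    Module.finrank ℂ (X.sum K) = Module.finrank ℂ X + Module.finrank ℂ K := by
  change Module.finrank ℂ (WithLp 2 (X × K)) = _
  rw [(WithLp.linearEquiv 2 ℂ (X × K)).finrank_eq, Module.finrank_prod]

/-- The direct sum of unitary operators. -/
noncomputable def UAut.sum (a : UAut X) (b : K ≃ₗᵢ[ℂ] K) : UAut (X.sum K) := unitarySum a b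

/-- The direct sum of unitary representations. -/
noncomputable def UAut.sumHom {G : Type*} [Group G] (f : G →* UAut X) (g : G →* (K ≃ₗᵢ[ℂ] K)) :
    G →* UAut (X.sum K) := unitarySumHom f g

theorem UAut.sum_mul (a a' : UAut X) (b b' : K ≃ₗᵢ[ℂ] K) :
    a.sum b * a'.sum b' = UAut.sum (a * a') (b * b') := rfl

theorem hsDist_sum (a a' : UAut X) (b b' : K ≃ₗᵢ[ℂ] K) :
    hsDist (X.sum K) (a.sum b) (a'.sum b') = Real.sqrt
      ((unitaryDistSq a a' + unitaryDistSq b b') /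
        (Module.finrank ℂ X + Module.finrank ℂ K)) := by
  rw [hsDist_eq, FDHilb.finrank_sum, Nat.cast_add]
  exact congrArg (fun x => Real.sqrt (x / _)) (unitaryDistSq_unitarySum a a' b b')

theorem hsDist_sum_le (a a' : UAut X) (b b' : K ≃ₗᵢ[ℂ] K) :
    hsDist (X.sum K) (a.sum b) (a'.sum b') ≤ hsDist X a a' +
      Real.sqrt (4 * ((Module.finrank ℂ K : ℝ) / Module.finrank ℂ X)) := by
  have hX := X.finrank_pos
  have h1 : (unitaryDistSq a a' + unitaryDistSq b b') /
      (Module.finrank ℂ X + Module.finrank ℂ K) ≤ unitaryDistSq a a' / Module.finrank ℂ X +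
        4 * ((Module.finrank ℂ K : ℝ) / Module.finrank ℂ X) := by
    rw [← mul_div_assoc, ← add_div]
    have := unitaryDistSq_nonneg a a'
    have := unitaryDistSq_le b b'
    gcongr
    simp
  rw [hsDist_sum, hsDist_eq]
  refine (Real.sqrt_le_sqrt h1).trans (Real.sqrt_le_iff.2 ⟨by positivity, ?_⟩)
  have h2 := Real.sq_sqrt (div_nonneg (unitaryDistSq_nonneg a a') hX.le)
  have h3 := Real.sq_sqrt (show 0 ≤ 4 * ((Module.finrank ℂ K : ℝ) / Module.finrank ℂ X) by
    positivity)
  nlinarith [mul_nonneg (Real.sqrt_nonneg (unitaryDistSq a a' / Module.finrank ℂ X))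
    (Real.sqrt_nonneg (4 * ((Module.finrank ℂ K : ℝ) / Module.finrank ℂ X)))]

theorem hsDist_sum_one (a a' : UAut X) :
    hsDist (X.sum K) (a.sum 1) (a'.sum (1 : K ≃ₗᵢ[ℂ] K)) ≤ hsDist X a a' := by
  have hX := X.finrank_pos
  have h0 : unitaryDistSq (1 : K ≃ₗᵢ[ℂ] K) 1 = 0 := by
    rw [unitaryDistSq_eq_sum _ _ (stdOrthonormalBasis ℂ K)]
    simp
  rw [hsDist_sum, hsDist_eq, h0, add_zero]
  refine Real.sqrt_le_sqrt ?_
  have := unitaryDistSq_nonneg a a'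
  gcongr
  simp

/-- The inclusion of the first summand. -/
noncomputable def FDHilb.inl (X : FDHilb) (K : Type) [NormedAddCommGroup K]
    [InnerProductSpace ℂ K] [FiniteDimensional ℂ K] : X →ₗᵢ[ℂ] X.sum K := l2Inl X K

theorem hsNorm_sub_compression_le (a : UAut X) (b : UAut (X.sum K)) :
    hsNorm X (a.lin - compression (X.inl K) b) ≤
      hsDist (X.sum K) (a.sum (1 : K ≃ₗᵢ[ℂ] K)) b *
        Real.sqrt ((Module.finrank ℂ (X.sum K) : ℝ) / Module.finrank ℂ X) := by
  have hX := X.finrank_pos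
  have hY := (X.sum K).finrank_pos
  rw [hsNorm_eq, hsDist_eq, ← Real.sqrt_mul (div_nonneg (unitaryDistSq_nonneg _ _) hY.le),
    div_mul_div_cancel₀ hY.ne']
  refine Real.sqrt_le_sqrt ?_
  gcongr
  exact frobSq_sub_compression_le (V := X) (K := K) a b

end HSSum

/-! ### Close subspaces and conjugation of close involutions -/

section Polar

variable {V E F : Type*} [NormedAddCommGroup V] [InnerProductSpace ℂ V] [FiniteDimensional ℂ V]
  [NormedAddCommGroup E] [InnerProductSpace ℂ E] [FiniteDimensional ℂ E]
  [NormedAddCommGroup F] [InnerProductSpace ℂ F] [FiniteDimensional ℂ F]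


/-- A contraction `A` between spaces of equal dimension is close to an isometry `w` in the sense
that `tr (A* A) ≤ Re tr (w* A)`. -/
theorem exists_isometry_inner_ge (hdim : finrank ℂ E = finrank ℂ F) (A : E →ₗ[ℂ] F)
    (hA : ∀ x, ‖A x‖ ≤ ‖x‖) :
    ∃ (e : OrthonormalBasis (Fin (finrank ℂ E)) ℂ E) (w : E ≃ₗᵢ[ℂ] F),
      ∑ i, ‖A (e i)‖ ^ 2 ≤ ∑ i, (inner ℂ (w (e i)) (A (e i))).re := by
  -- This is a polar decomposition: on an eigenbasis of `A* A` the images `A (e i)` are pairwise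
  -- orthogonal. Normalizing the nonzero ones and completing them to an orthonormal basis of `F`
  -- defines `w`.
  have hT := LinearMap.isSymmetric_adjoint_comp_self A
  let e := hT.eigenvectorBasis rfl
  let s : Set (Fin (finrank ℂ E)) := {i | A (e i) ≠ 0}
  let v : Fin (finrank ℂ E) → F := fun i => ((‖A (e i)‖⁻¹ : ℝ) : ℂ) • A (e i)
  have horth : ∀ i j, i ≠ j → inner ℂ (A (e i)) (A (e j)) = 0 := by
    intro i j hij
    rw [← LinearMap.adjoint_inner_right, ← LinearMap.comp_apply,
      hT.apply_eigenvectorBasis rfl j, inner_smul_right, e.inner_eq_zero hij, mul_zero]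
  have hv : Orthonormal ℂ (s.domRestrict v) := by
    constructor
    · rintro ⟨i, hi⟩
      change ‖v i‖ = 1
      rw [norm_smul, Complex.norm_real, norm_inv, norm_norm,
        inv_mul_cancel₀ (norm_ne_zero_iff.2 hi)]
    · rintro ⟨i, hi⟩ ⟨j, hj⟩ hij
      change inner ℂ (v i) (v j) = 0
      rw [inner_smul_left, inner_smul_right, horth i j fun h => hij (Subtype.ext h), mul_zero,
        mul_zero]
  obtain ⟨f, hf⟩ := hv.exists_orthonormalBasis_extension_of_card_eq (by simp [hdim])
  refine ⟨e, e.equiv f (Equiv.refl _), Finset.sum_le_sum fun i _ => ?_⟩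
  rw [OrthonormalBasis.equiv_apply_basis, Equiv.refl_apply]
  by_cases hi : A (e i) = 0
  · simp [hi]
  · rw [hf i hi, inner_smul_left, inner_self_eq_norm_sq_to_K, Complex.conj_ofReal]
    have hpos := norm_pos_iff.2 hi
    have hle := hA (e i)
    rw [e.norm_eq_one] at hle
    have h1 : ((‖A (e i)‖⁻¹ : ℝ) : ℂ) * ((‖A (e i)‖ : ℝ) : ℂ) ^ 2 = ((‖A (e i)‖ : ℝ) : ℂ) := by
      rw [← Complex.ofReal_pow, ← Complex.ofReal_mul]
      congr 1
      field_simp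
    -- The inner product equals `‖A (e i)‖`, which dominates its square because `A` is a
    -- contraction.
    refine le_of_le_of_eq ?_ (congrArg Complex.re h1).symm
    rw [Complex.ofReal_re]
    nlinarith

/-- Two subspaces of the same dimension are related by an isometry that moves an orthonormal
basis not much more than the orthogonal projection does. -/
theorem Submodule.exists_isometry_sum_norm_sub_le (P Q : Submodule ℂ V)
    (hdim : finrank ℂ P = finrank ℂ Q) :
    ∃ (e : OrthonormalBasis (Fin (finrank ℂ P)) ℂ P) (w : P ≃ₗᵢ[ℂ] Q),
      ∑ i, ‖(w (e i) : V) - e i‖ ^ 2 ≤ ∑ i, 2 * ‖(e i : V) - Q.starProjection (e i)‖ ^ 2 := by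
  obtain ⟨e, w, h⟩ := exists_isometry_inner_ge hdim
    ((Q.orthogonalProjectionOnto : V →ₗ[ℂ] Q) ∘ₗ P.subtype)
    fun x => Q.norm_orthogonalProjectionOnto_apply_le x
  refine ⟨e, w, ?_⟩
  have h1 : ∀ i, ‖(w (e i) : V) - e i‖ ^ 2 =
      2 - 2 * (inner ℂ (w (e i)) (Q.orthogonalProjectionOnto (e i : V))).re := by
    intro i
    rw [@norm_sub_sq ℂ, Submodule.inner_orthogonalProjectionOnto_eq_of_mem_left,
      ← Submodule.coe_norm, ← Submodule.coe_norm, w.norm_map, e.norm_eq_one, RCLike.re_eq_complex_re]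
    ring
  have h2 : ∀ i, 2 * ‖(e i : V) - Q.starProjection (e i)‖ ^ 2 =
      2 - 2 * ‖Q.orthogonalProjectionOnto (e i : V)‖ ^ 2 := by
    intro i
    have h3 := Q.norm_sq_eq_add_norm_sq_starProjection (e i : V)
    rw [Submodule.starProjection_orthogonal_val, ← Submodule.coe_orthogonalProjectionOnto_apply,
      ← Submodule.coe_norm, ← Submodule.coe_norm, e.norm_eq_one] at h3
    rw [← Submodule.coe_orthogonalProjectionOnto_apply]
    linarith
  simp only [h1, h2, Finset.sum_sub_distrib, ← Finset.mul_sum]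
  simp only [LinearMap.comp_apply] at h
  exact sub_le_sub_left (mul_le_mul_of_nonneg_left h two_pos.le) _

/-- An involution preserves `Pᗮ`, where `P` is its `-1`-eigenspace. For `y` in `Pᗮ` the vector `y -
a y` lies in both `P` and `Pᗮ`, hence vanishes, so `a` is the reflection with `-1` on `P`. -/
theorem apply_eq_sub_two_smul_starProjection {a : V ≃ₗᵢ[ℂ] V} (ha : a ^ 2 = 1) (x : V) :
    a x = x - (2 : ℂ) • (LinearMap.ker
      ((a.toLinearEquiv : V →ₗ[ℂ] V) + LinearMap.id)).starProjection x := by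
  set P := LinearMap.ker ((a.toLinearEquiv : V →ₗ[ℂ] V) + LinearMap.id)
  have hfix : ∀ y ∈ Pᗮ, a y = y := by
    intro y hy
    have hay : a y ∈ Pᗮ := by
      refine (P.mem_orthogonal _).2 fun z hz => ?_
      have haz := (mem_ker_add_id_iff a z).1 hz
      rw [← a.inner_map_map, apply_apply_of_sq_eq_one ha, haz, inner_neg_left,
        (P.mem_orthogonal _).1 hy z hz, neg_zero]
    have hsub : y - a y ∈ P := by
      refine (mem_ker_add_id_iff a _).2 ?_
      rw [map_sub, apply_apply_of_sq_eq_one ha, neg_sub]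
    have h0 := P.orthogonal_disjoint.le_bot ⟨hsub, Pᗮ.sub_mem hy hay⟩
    exact (sub_eq_zero.1 ((Submodule.mem_bot ℂ).1 h0)).symm
  have h1 := hfix _ (P.sub_starProjection_mem_orthogonal x)
  have h2 := (mem_ker_add_id_iff a _).1 (P.starProjection_apply_mem x)
  rw [map_sub, h2, sub_neg_eq_add] at h1
  rw [two_smul, eq_sub_of_add_eq h1]
  abel

/-- Two unitary involutions with equal traces are conjugate by a unitary operator that is not
farther from the identity than the involutions are from each other. -/
theorem exists_conj_of_negDim_eq {a b : V ≃ₗᵢ[ℂ] V} (ha : a ^ 2 = 1) (hb : b ^ 2 = 1)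
    (h : negDim a = negDim b) :
    ∃ w : V ≃ₗᵢ[ℂ] V, w * a * w⁻¹ = b ∧ unitaryDistSq w 1 ≤ unitaryDistSq a b := by
  have hax := apply_eq_sub_two_smul_starProjection ha
  have hbx := apply_eq_sub_two_smul_starProjection hb
  unfold negDim at h
  set P := LinearMap.ker ((a.toLinearEquiv : V →ₗ[ℂ] V) + LinearMap.id)
  set Q := LinearMap.ker ((b.toLinearEquiv : V →ₗ[ℂ] V) + LinearMap.id)
  have h' : finrank ℂ Pᗮ = finrank ℂ Qᗮ := by
    have h1 := P.finrank_add_finrank_orthogonal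
    have h2 := Q.finrank_add_finrank_orthogonal
    omega
  obtain ⟨e, w₁, he⟩ := P.exists_isometry_sum_norm_sub_le Q h
  obtain ⟨f, w₂, hf⟩ := Pᗮ.exists_isometry_sum_norm_sub_le Qᗮ h'
  -- Matching `P` with `Q` and `Pᗮ` with `Qᗮ` separately makes `w` intertwine the two reflections.
  let w : V ≃ₗᵢ[ℂ] V := P.orthogonalDecomposition.trans
    ((LinearIsometryEquiv.withLpProdCongr 2 w₁ w₂).trans Q.orthogonalDecomposition.symm)
  have hP : ∀ x : P, P.orthogonalDecomposition x = WithLp.toLp 2 (x, 0) := fun x => by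
    rw [Submodule.orthogonalDecomposition_apply]
    simp
  have hP' : ∀ x : Pᗮ, P.orthogonalDecomposition x = WithLp.toLp 2 (0, x) := fun x => by
    rw [Submodule.orthogonalDecomposition_apply]
    simp
  have hw₁ : ∀ x : P, w x = w₁ x := fun x => by
    simp [w, hP, -Submodule.orthogonalDecomposition_apply]
  have hw₂ : ∀ x : Pᗮ, w x = w₂ x := fun x => by
    simp [w, hP', -Submodule.orthogonalDecomposition_apply]
  have haP : ∀ x : P, a x = -x := fun x => (mem_ker_add_id_iff a x).1 x.2
  have hbQ : ∀ x : Q, b x = -x := fun x => (mem_ker_add_id_iff b x).1 x.2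
  have haP' : ∀ x : Pᗮ, a x = x := fun x => by
    rw [hax, P.starProjection_apply_eq_zero_iff.2 x.2, smul_zero, sub_zero]
  have hbQ' : ∀ x : Qᗮ, b x = x := fun x => by
    rw [hbx, Q.starProjection_apply_eq_zero_iff.2 x.2, smul_zero, sub_zero]
  refine ⟨w, ?_, ?_⟩
  · rw [mul_inv_eq_iff_eq_mul]
    ext x
    obtain ⟨y, hy, z, hz, rfl⟩ := P.exists_add_mem_mem_orthogonal x
    lift y to P using hy
    lift z to Pᗮ using hz
    rw [LinearIsometryEquiv.coe_mul, LinearIsometryEquiv.coe_mul, Function.comp_apply,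
      Function.comp_apply, map_add, map_add, map_add, map_add, haP, haP', map_neg, hw₁, hw₂,
      hbQ, hbQ']
  · let c := (e.prod f).map P.orthogonalDecomposition.symm
    have hc₁ : ∀ i, c (Sum.inl i) = e i := fun i => by simp [c]
    have hc₂ : ∀ i, c (Sum.inr i) = f i := fun i => by simp [c]
    rw [unitaryDistSq_eq_sum w 1 c, unitaryDistSq_eq_sum a b c, Fintype.sum_sum_type,
      Fintype.sum_sum_type]
    simp only [hc₁, hc₂, hw₁, hw₂, LinearIsometryEquiv.coe_one, id]
    refine add_le_add (he.trans ?_) (hf.trans ?_)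
    -- On `P` the difference `a - b` is `-2` times the component orthogonal to `Q`. Its square
    -- carries a factor 4, which absorbs the factor 2 lost in choosing `w₁`.
    · refine Finset.sum_le_sum fun i _ => ?_
      rw [haP, hbx, show -(e i : V) - (e i - (2 : ℂ) • Q.starProjection (e i)) =
        (-2 : ℂ) • ((e i : V) - Q.starProjection (e i)) by module, norm_smul, mul_pow]
      norm_num
      nlinarith [sq_nonneg ‖(e i : V) - Q.starProjection (e i)‖]
    · refine Finset.sum_le_sum fun i _ => ?_
      rw [haP', hbx, Submodule.starProjection_orthogonal_val, sub_sub_cancel, sub_sub_cancel,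
        norm_smul, mul_pow]
      norm_num
      nlinarith [sq_nonneg ‖Q.starProjection (f i : V)‖]

end Polar

/-! ### Invariant subspaces and complete reducibility -/

section Invariant

variable {H : Type*} [Group H] {V : Type*} [NormedAddCommGroup V] [InnerProductSpace ℂ V]

/-- A subspace is invariant under a unitary representation. -/
def IsInvariantSubspace (ρ : H →* (V ≃ₗᵢ[ℂ] V)) (W : Submodule ℂ V) : Prop :=
  ∀ g, ∀ x ∈ W, ρ g x ∈ W

theorem rep_inv_apply (ρ : H →* (V ≃ₗᵢ[ℂ] V)) (g : H) (x : V) : ρ g (ρ g⁻¹ x) = x := by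
  have h : ρ g * ρ g⁻¹ = 1 := by rw [← map_mul, mul_inv_cancel, map_one]
  exact DFunLike.congr_fun h x

theorem rep_inv_apply' (ρ : H →* (V ≃ₗᵢ[ℂ] V)) (g : H) (x : V) : ρ g⁻¹ (ρ g x) = x := by
  have h : ρ g⁻¹ * ρ g = 1 := by rw [← map_mul, inv_mul_cancel, map_one]
  exact DFunLike.congr_fun h x

theorem IsInvariantSubspace.orthogonal {ρ : H →* (V ≃ₗᵢ[ℂ] V)} {W : Submodule ℂ V}
    (hW : IsInvariantSubspace ρ W) : IsInvariantSubspace ρ Wᗮ := by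
  intro g x hx
  refine (W.mem_orthogonal _).2 fun y hy => ?_
  rw [← rep_inv_apply ρ g y, LinearIsometryEquiv.inner_map_map]
  exact (W.mem_orthogonal _).1 hx _ (hW _ _ hy)

/-- The restriction of a unitary representation to an invariant subspace. -/
def restrictHom (ρ : H →* (V ≃ₗᵢ[ℂ] V)) {W : Submodule ℂ V} (hW : IsInvariantSubspace ρ W) :
    H →* (W ≃ₗᵢ[ℂ] W) where
  toFun g :=
    { toFun := fun x => ⟨ρ g x, hW g x x.2⟩
      invFun := fun x => ⟨ρ g⁻¹ x, hW g⁻¹ x x.2⟩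
      left_inv := fun x => Subtype.ext (rep_inv_apply' ρ g x)
      right_inv := fun x => Subtype.ext (rep_inv_apply ρ g x)
      map_add' := fun x y => Subtype.ext (map_add _ _ _)
      map_smul' := fun c x => Subtype.ext (map_smul _ _ _)
      norm_map' := fun x => (ρ g).norm_map x }
  map_one' := by
    ext x
    exact DFunLike.congr_fun (map_one ρ) (x : V)
  map_mul' g h := by
    ext x
    exact DFunLike.congr_fun (map_mul ρ g h) (x : V)

theorem IsInvariantSubspace.inf {ρ : H →* (V ≃ₗᵢ[ℂ] V)} {W W' : Submodule ℂ V}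
    (hW : IsInvariantSubspace ρ W) (hW' : IsInvariantSubspace ρ W') :
    IsInvariantSubspace ρ (W ⊓ W') := fun g x hx => ⟨hW g x hx.1, hW' g x hx.2⟩

/-- Induction over the decomposition of a finite-dimensional unitary representation into
irreducible subrepresentations. -/
theorem IsInvariantSubspace.induction_on [FiniteDimensional ℂ V] {ρ : H →* (V ≃ₗᵢ[ℂ] V)}
    {p : Submodule ℂ V → Prop} (hbot : p ⊥)
    (hsup : ∀ M W, IsInvariantSubspace ρ M → IsInvariantSubspace ρ W → M ≠ ⊥ →
      (∀ N ≤ M, IsInvariantSubspace ρ N → N = ⊥ ∨ N = M) → M ⟂ W → p W → p (M ⊔ W))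
    {W : Submodule ℂ V} (hW : IsInvariantSubspace ρ W) : p W := by
  induction hn : finrank ℂ W using Nat.strong_induction_on generalizing W with
  | _ n ih =>
    by_cases h0 : W = ⊥
    · exact h0 ▸ hbot
    -- A nonzero invariant subspace of least dimension is irreducible; it is split off and the
    -- induction continues in its orthogonal complement.
    obtain ⟨M, ⟨hMW, hMinv, hM0⟩, hmin⟩ := (measure fun M : Submodule ℂ V => finrank ℂ M).wf.has_min
      {M | M ≤ W ∧ IsInvariantSubspace ρ M ∧ M ≠ ⊥} ⟨W, le_rfl, hW, h0⟩
    have hsum := Submodule.finrank_add_inf_finrank_orthogonal hMW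
    have hpos : finrank ℂ M ≠ 0 := mt Submodule.finrank_eq_zero.1 hM0
    rw [← Submodule.sup_orthogonal_inf_of_hasOrthogonalProjection hMW]
    have hinv := hMinv.orthogonal.inf hW
    refine hsup M _ hMinv hinv hM0 (fun N hN hNinv => ?_)
      ((Submodule.isOrtho_orthogonal_right M).mono_right inf_le_left)
      (ih _ (by omega) hinv rfl)
    by_contra! hcon
    refine hmin N ⟨hN.trans hMW, hNinv, hcon.1⟩ ?_
    exact Submodule.finrank_lt_finrank_of_lt (lt_of_le_of_ne hN hcon.2)

/-- The irreducible representation on a minimal invariant subspace. -/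
noncomputable def IrrUnitaryRep.ofMinimal {V : Type} [NormedAddCommGroup V] [InnerProductSpace ℂ V]
    [FiniteDimensional ℂ V] (ρ : H →* (V ≃ₗᵢ[ℂ] V)) {M : Submodule ℂ V}
    (hM : IsInvariantSubspace ρ M) (hM0 : M ≠ ⊥)
    (hmin : ∀ N ≤ M, IsInvariantSubspace ρ N → N = ⊥ ∨ N = M) : IrrUnitaryRep H where
  space :=
    have : Nontrivial M := Submodule.nontrivial_iff_ne_bot.2 hM0
    ⟨M⟩
  hom := restrictHom ρ hM
  irreducible W hW := by
    let N : Submodule ℂ V := Submodule.map M.subtype W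
    have hN : IsInvariantSubspace ρ N := by
      rintro g _ ⟨x, hx, rfl⟩
      exact ⟨_, hW g x hx, rfl⟩
    have hinj : Function.Injective M.subtype := Subtype.val_injective
    refine (hmin N (Submodule.map_subtype_le M W) hN).imp (fun h => ?_) fun h => ?_
    · exact Submodule.map_injective_of_injective hinj (h.trans (Submodule.map_bot _).symm)
    · refine Submodule.map_injective_of_injective hinj (h.trans ?_)
      exact (Submodule.map_subtype_top M).symm

end Invariant

/-! ### Groups with exactly two irreducible unitary representations -/

namespace IrrUnitaryRep

variable {H : Type*} [Group H]

/-- The trivial representation. -/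
noncomputable def trivial (H : Type*) [Group H] : IrrUnitaryRep H where
  space := ⟨ℂ⟩
  hom := 1
  irreducible W _ := eq_bot_or_eq_top (α := Submodule ℂ ℂ) W

theorem hom_eq_one {S T : IrrUnitaryRep H} (h : (setoid H).r S T) {x : H}
    (hx : T.hom x = 1) : S.hom x = 1 := by
  obtain ⟨e, he⟩ := h
  ext y
  exact e.injective (by rw [he, hx]; rfl)

theorem finrank_eq {S T : IrrUnitaryRep H} (h : (setoid H).r S T) :
    finrank ℂ S.space = finrank ℂ T.space := h.choose.toLinearEquiv.finrank_eq

theorem equiv_trivial {S : IrrUnitaryRep H} (hS : ∀ h, S.hom h = 1)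
    (hdim : finrank ℂ S.space = 1) : (setoid H).r S (trivial H) :=
  ⟨((stdOrthonormalBasis ℂ S.space).reindex (finCongr hdim)).equiv
    (OrthonormalBasis.singleton (Fin 1) ℂ) (Equiv.refl _),
    fun g x => by rw [hS]; rfl⟩

/-- Schur's lemma. -/
theorem exists_eq_smul (S : IrrUnitaryRep H) (A : S.space →ₗ[ℂ] S.space)
    (hA : ∀ g x, A (S.hom g x) = S.hom g (A x)) : ∃ c : ℂ, ∀ x, A x = c • x := by
  obtain ⟨c, hc⟩ := Module.End.exists_eigenvalue A
  refine ⟨c, fun x => ?_⟩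
  have htop := (S.irreducible (Module.End.eigenspace A c) fun g w hw => by
    rw [Module.End.mem_eigenspace_iff] at hw ⊢
    rw [hA, hw, map_smul]).resolve_left hc
  exact Module.End.mem_eigenspace_iff.1 (htop ▸ Submodule.mem_top)

section HilbertSchmidt

variable (V : Type) [NormedAddCommGroup V] [InnerProductSpace ℂ V] [FiniteDimensional ℂ V]

/-- The Hilbert–Schmidt inner product on the operators of a finite-dimensional Hilbert space. -/
noncomputable abbrev hsCore : InnerProductSpace.Core ℂ (V →ₗ[ℂ] V) where
  inner A B := ∑ i, inner ℂ (A (stdOrthonormalBasis ℂ V i)) (B (stdOrthonormalBasis ℂ V i))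
  conj_inner_symm A B := by simp only [map_sum, inner_conj_symm]
  re_inner_nonneg A := by
    rw [map_sum]
    exact Finset.sum_nonneg fun i _ => inner_self_nonneg
  add_left A B C := by
    simp only [LinearMap.add_apply, inner_add_left, Finset.sum_add_distrib]
  smul_left A B c := by
    simp only [LinearMap.smul_apply, inner_smul_left, Finset.mul_sum]
  definite A hA := by
    have h : ∀ i, A (stdOrthonormalBasis ℂ V i) = 0 := by
      have h1 := congrArg RCLike.re hA
      rw [map_sum, map_zero,
        Finset.sum_eq_zero_iff_of_nonneg fun i _ => inner_self_nonneg (𝕜 := ℂ)] at h1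
      intro i
      have h2 := h1 i (Finset.mem_univ i)
      rwa [inner_self_eq_norm_sq, sq_eq_zero_iff, norm_eq_zero] at h2
    exact (stdOrthonormalBasis ℂ V).toBasis.ext fun i => by simpa using h i

/-- The conjugation action on operators is unitary and, for an irreducible representation,
fixes only the scalars. -/
theorem exists_adjointRep (S : IrrUnitaryRep H) :
    ∃ (V : Type) (_ : NormedAddCommGroup V) (_ : InnerProductSpace ℂ V)
      (_ : FiniteDimensional ℂ V) (ρ : H →* (V ≃ₗᵢ[ℂ] V)) (v : V), v ≠ 0 ∧
      finrank ℂ V = finrank ℂ S.space ^ 2 ∧ (∀ g, ρ g v = v) ∧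
      ∀ x, (∀ g, ρ g x = x) → ∃ c : ℂ, x = c • v := by
  let E := S.space →ₗ[ℂ] S.space
  let core := hsCore S.space
  let i₁ : NormedAddCommGroup E := core.toNormedAddCommGroup
  let i₂ : InnerProductSpace ℂ E := InnerProductSpace.ofCore core.toCore
  have hfin : FiniteDimensional ℂ E := inferInstance
  have hnorm : ∀ A : E, ‖A‖ = Real.sqrt (frobSq A) := fun A => by
    rw [frobSq_eq_sum A (stdOrthonormalBasis ℂ S.space), @norm_eq_sqrt_re_inner ℂ]
    congr 1
    change RCLike.re (∑ i, inner ℂ (A _) (A _)) = _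
    rw [map_sum]
    exact Finset.sum_congr rfl fun i _ => inner_self_eq_norm_sq (𝕜 := ℂ) _
  have hconj : ∀ g (A : E) x, (S.hom g).toLinearEquiv.conj A (S.hom g x) = S.hom g (A x) :=
    fun g A x => congrArg (fun y => S.hom g (A y)) ((S.hom g).symm_apply_apply x)
  let ρ : H →* (E ≃ₗᵢ[ℂ] E) :=
    { toFun := fun g =>
        { toLinearEquiv := (S.hom g).toLinearEquiv.conj
          norm_map' := fun A => by
            -- Computing the norm of the conjugate in the basis transported by `S.hom g` makes the
            -- two sums agree term by term.
            rw [hnorm, hnorm, frobSq_eq_sum A (stdOrthonormalBasis ℂ S.space),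
              frobSq_eq_sum _ ((stdOrthonormalBasis ℂ S.space).map (S.hom g))]
            simp only [OrthonormalBasis.map_apply]
            congr 1
            refine Finset.sum_congr rfl fun i _ => ?_
            rw [← (S.hom g).norm_map (A _), ← hconj] }
      map_one' := by
        ext A x
        change S.hom 1 (A ((S.hom 1).symm x)) = A x
        rw [map_one]
        rfl
      map_mul' := fun g h => by
        ext A x
        change S.hom (g * h) (A ((S.hom (g * h)).symm x)) = _
        rw [map_mul]
        rfl }
  refine ⟨E, i₁, i₂, hfin, ρ, LinearMap.id, ?_, ?_, fun g => ?_, fun A hA => ?_⟩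
  · intro h
    obtain ⟨x, hx⟩ := exists_ne (0 : S.space)
    exact hx (DFunLike.congr_fun h x)
  · exact (Module.finrank_linearMap ℂ ℂ S.space S.space).trans (sq _).symm
  · refine LinearMap.ext fun x => ?_
    exact (S.hom g).apply_symm_apply x
  · obtain ⟨c, hc⟩ := S.exists_eq_smul A fun g x => by
      conv_lhs => rw [← hA g]
      exact hconj g A x
    exact ⟨c, LinearMap.ext hc⟩

end HilbertSchmidt

/-- The two classes of irreducible representations are those of the trivial representation and
of `S`. -/
def IsTwoClass (S : IrrUnitaryRep H) : Prop :=
  ¬ (setoid H).r S (trivial H) ∧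
    ∀ T : IrrUnitaryRep H, (setoid H).r T (trivial H) ∨ (setoid H).r T S

section TwoClass

variable {S : IrrUnitaryRep H} {V : Type} [NormedAddCommGroup V] [InnerProductSpace ℂ V]
  [FiniteDimensional ℂ V] {ρ : H →* (V ≃ₗᵢ[ℂ] V)}

theorem apply_eq_of_ofMinimal_hom_eq_one {M : Submodule ℂ V} (hM : IsInvariantSubspace ρ M)
    (hM0 : M ≠ ⊥) (hmin : ∀ N ≤ M, IsInvariantSubspace ρ N → N = ⊥ ∨ N = M) {h : H}
    (h1 : (ofMinimal ρ hM hM0 hmin).hom h = 1) {x : V} (hx : x ∈ M) : ρ h x = x := by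
  have h2 : restrictHom ρ hM h = 1 := h1
  exact congrArg Subtype.val (DFunLike.congr_fun h2 ⟨x, hx⟩)

/-- Each irreducible summand of `ρ` is trivial or a copy of `S`, and `h` acts trivially on both
kinds. -/
theorem IsTwoClass.eq_one (hS : IsTwoClass S) {h : H} (hh : S.hom h = 1) : ρ h = 1 := by
  have htop : IsInvariantSubspace ρ ⊤ := fun _ _ _ => Submodule.mem_top
  have key : ∀ x ∈ (⊤ : Submodule ℂ V), ρ h x = x := by
    refine htop.induction_on (p := fun W => ∀ x ∈ W, ρ h x = x) ?_ ?_
    · rintro x hx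
      rw [(Submodule.mem_bot ℂ).1 hx, map_zero]
    · intro M W hM hW hM0 hmin _ hpW x hx
      obtain ⟨y, hy, z, hz, rfl⟩ := Submodule.mem_sup.1 hx
      rw [map_add, hpW z hz]
      congr 1
      refine apply_eq_of_ofMinimal_hom_eq_one hM hM0 hmin ?_ hy
      rcases hS.2 (ofMinimal ρ hM hM0 hmin) with hT | hT
      · exact hom_eq_one hT rfl
      · exact hom_eq_one hT hh
  ext x
  exact key x Submodule.mem_top

/-- Without nonzero fixed vectors, only copies of `S` occur in `W`. -/
theorem IsTwoClass.dvd_finrank (hS : IsTwoClass S) {W : Submodule ℂ V}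
    (hW : IsInvariantSubspace ρ W) (hfix : ∀ x ∈ W, (∀ g, ρ g x = x) → x = 0) :
    finrank ℂ S.space ∣ finrank ℂ W := by
  refine hW.induction_on (p := fun W => (∀ x ∈ W, (∀ g, ρ g x = x) → x = 0) →
    finrank ℂ S.space ∣ finrank ℂ W) (by simp) ?_ hfix
  intro M W hM hW hM0 hmin horth hpW hfix
  have hsum := Submodule.finrank_sup_add_finrank_inf_eq M W
  rw [horth.disjoint.eq_bot, finrank_bot, add_zero] at hsum
  rw [hsum]
  refine dvd_add ?_ (hpW fun x hx => hfix x (Submodule.mem_sup_right hx))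
  rcases hS.2 (ofMinimal ρ hM hM0 hmin) with hT | hT
  · refine absurd (M.eq_bot_iff.2 fun x hx => ?_) hM0
    exact hfix x (Submodule.mem_sup_left hx) fun g =>
      apply_eq_of_ofMinimal_hom_eq_one hM hM0 hmin (hom_eq_one hT rfl) hx
  · exact (finrank_eq hT).symm.dvd

/-- Let `d` be the dimension of `S`. In the conjugation action on operators, of dimension `d ^ 2`,
the fixed vectors are the scalars by Schur's lemma. Their complement has no nonzero fixed vectors,
so `d` divides `d ^ 2 - 1`, forcing `d = 1`. -/
theorem IsTwoClass.finrank_eq_one (hS : IsTwoClass S) : finrank ℂ S.space = 1 := by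
  obtain ⟨V, _, _, _, ρ, v, hv, hdim, hfix, hscalar⟩ := exists_adjointRep S
  have hinv : IsInvariantSubspace ρ (ℂ ∙ v) := by
    intro g x hx
    obtain ⟨c, rfl⟩ := Submodule.mem_span_singleton.1 hx
    rw [map_smul, hfix]
    exact hx
  have hdvd := hS.dvd_finrank hinv.orthogonal fun x hx hx' => by
    obtain ⟨c, rfl⟩ := hscalar x hx'
    exact (Submodule.mem_bot ℂ).1 ((ℂ ∙ v).orthogonal_disjoint.le_bot
      ⟨Submodule.smul_mem _ c (Submodule.mem_span_singleton_self v), hx⟩)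
  have hsum := (ℂ ∙ v).finrank_add_finrank_orthogonal
  rw [finrank_span_singleton hv, hdim] at hsum
  have h1 : finrank ℂ S.space ∣ 1 + finrank ℂ (ℂ ∙ v)ᗮ := hsum ▸ dvd_pow_self _ two_ne_zero
  exact Nat.dvd_one.1 ((Nat.dvd_add_left hdvd).1 h1)

end TwoClass

/-- A group with exactly two irreducible finite-dimensional unitary representations and enough
finite-dimensional unitary representations to separate points has order two. -/
theorem exists_involution_generator
    (hres : ∀ h : H, h ≠ 1 → ∃ (X : FDHilb) (ψ : H →* UAut X), ψ h ≠ 1)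
    (hrank : Module.rank ℤ (LambdaHS H) = 2) :
    ∃ h₀ : H, h₀ ^ 2 = 1 ∧ h₀ ≠ 1 ∧ ∀ h, h ∈ Subgroup.zpowers h₀ := by
  obtain ⟨a, hat, ha⟩ := exists_ne_and_forall_eq_or_eq_of_rank_eq_two hrank
    (Quotient.mk (setoid H) (trivial H))
  obtain ⟨S, rfl⟩ := Quotient.exists_rep a
  have hS : IsTwoClass S := ⟨fun h => hat (Quotient.sound h),
    fun T => (ha (Quotient.mk _ T)).imp Quotient.exact Quotient.exact⟩
  have hdim := hS.finrank_eq_one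
  have hinj : Function.Injective S.hom := by
    refine (injective_iff_map_eq_one _).2 fun h hh => ?_
    by_contra hne
    obtain ⟨X, ψ, hψ⟩ := hres h hne
    exact hψ (hS.eq_one hh)
  obtain ⟨v, hv⟩ := exists_ne (0 : S.space)
  have hscalar : ∀ (T : S.space →ₗ[ℂ] S.space), ∃ c : ℂ, ∀ x, T x = c • x := by
    intro T
    obtain ⟨c, hc⟩ := (finrank_eq_one_iff_of_nonzero' v hv).1 hdim (T v)
    refine ⟨c, fun x => ?_⟩
    obtain ⟨d, rfl⟩ := (finrank_eq_one_iff_of_nonzero' v hv).1 hdim x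
    rw [map_smul, ← hc, smul_comm]
  choose c hc using fun h => hscalar (S.hom h).toLinearEquiv.toLinearMap
  replace hc : ∀ h x, S.hom h x = c h • x := hc
  have hone : ∀ {h}, c h = 1 → h = 1 := fun {h} h1 => hinj <| by
    rw [map_one]
    ext x
    rw [hc, h1, one_smul]
    rfl
  obtain ⟨h₀, hne⟩ : ∃ h₀ : H, h₀ ≠ 1 := by
    by_contra! hcon
    exact hS.1 (equiv_trivial (fun h => by rw [hcon h, map_one]) hdim)
  have hcomm : ∀ g h, Commute (S.hom g) (S.hom h) := fun g h => by
    ext x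
    change S.hom g (S.hom h x) = S.hom h (S.hom g x)
    rw [hc h, map_smul, hc h]
  -- The square of the character `c` is again a character, hence equal to 1 or to `c`. The latter
  -- would make `c` trivial, contradicting faithfulness at `h₀`; so `c` takes only the values `1`
  -- and `-1`.
  let T : IrrUnitaryRep H :=
    { space := S.space
      hom :=
        { toFun := fun h => S.hom h ^ 2
          map_one' := by rw [map_one, one_pow]
          map_mul' := fun g h => by rw [map_mul, (hcomm g h).mul_pow] }
      irreducible := fun W hW => S.irreducible W fun g w hw => by
        rw [hc]
        exact W.smul_mem _ hw }
  have hT : ∀ h x, T.hom h x = (c h * c h) • x := fun h x => by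
    change (S.hom h ^ 2) x = _
    rw [sq]
    change S.hom h (S.hom h x) = _
    rw [hc h, hc h, smul_smul]
  have hsq : ∀ h, c h * c h = 1 := by
    rcases hS.2 T with hr | hr
    · intro h
      have h1 : T.hom h = 1 := hom_eq_one hr rfl
      have h2 := hT h v
      rw [h1] at h2
      exact (smul_left_injective ℂ hv (h2.symm.trans (one_smul ℂ v).symm))
    · obtain ⟨e, he⟩ := hr
      refine absurd (hone ?_) hne
      have hev : e v ≠ 0 := (map_ne_zero_iff e e.injective).2 hv
      have h1 := he h₀ v
      rw [hT, hc, map_smul] at h1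
      have h2 := smul_left_injective ℂ hev h1
      have hc0 : c h₀ ≠ 0 := by
        intro h0
        have h3 := hc h₀ v
        rw [h0, zero_smul] at h3
        exact hv ((map_eq_zero_iff _ (S.hom h₀).injective).1 h3)
      exact mul_left_cancel₀ hc0 (h2.trans (mul_one _).symm)
  have hneg : ∀ {h}, h ≠ 1 → c h = -1 := fun {h} hh =>
    (mul_self_eq_one_iff.1 (hsq h)).resolve_left (mt hone hh)
  have heq : ∀ {h}, h ≠ 1 → h = h₀ := fun {h} hh => hinj <| by
    ext x
    rw [hc, hc, hneg hh, hneg hne]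
  refine ⟨h₀, hinj ?_, hne, fun h => ?_⟩
  · rw [map_pow, map_one]
    ext x
    exact (hT h₀ x).trans (by rw [hsq, one_smul]; rfl)
  · by_cases hh : h = 1
    · exact hh ▸ Subgroup.one_mem _
    · exact heq hh ▸ Subgroup.mem_zpowers h₀

end IrrUnitaryRep

/-! ### The theorem for unitary groups -/

/-- The differences of the dimensions of the `-1`-eigenspaces of two involutions `g₁` and `g₂` in
unitary representations of two groups on the same finite-dimensional Hilbert space, together with
the dimension of this space. -/
def negDimDiff {G₁ G₂ : Type*} [Group G₁] [Group G₂] {g₁ : G₁} {g₂ : G₂} (h₁ : g₁ ^ 2 = 1)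
    (h₂ : g₂ ^ 2 = 1) : AddSubmonoid (ℤ × ℕ) where
  carrier := {x | ∃ (K : Type) (_ : NormedAddCommGroup K) (_ : InnerProductSpace ℂ K)
    (_ : FiniteDimensional ℂ K) (f₁ : G₁ →* (K ≃ₗᵢ[ℂ] K)) (f₂ : G₂ →* (K ≃ₗᵢ[ℂ] K)),
      x = ((negDim (f₁ g₁) : ℤ) - negDim (f₂ g₂), finrank ℂ K)}
  zero_mem' := ⟨EuclideanSpace ℂ (Fin 0), inferInstance, inferInstance, inferInstance, 1, 1, by
    simp only [MonoidHom.one_apply, sub_self, finrank_euclideanSpace, Fintype.card_fin]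
    rfl⟩
  add_mem' := by
    rintro _ _ ⟨K, _, _, _, f₁, f₂, rfl⟩ ⟨L, _, _, _, f₁', f₂', rfl⟩
    refine ⟨WithLp 2 (K × L), inferInstance, inferInstance, inferInstance,
      unitarySumHom f₁ f₁', unitarySumHom f₂ f₂', ?_⟩
    have k₁ : negDim (unitarySumHom f₁ f₁' g₁) = _ := negDim_unitarySum
      (a := f₁ g₁) (b := f₁' g₁) (by rw [← map_pow, h₁, map_one]) (by rw [← map_pow, h₁, map_one])
    have k₂ : negDim (unitarySumHom f₂ f₂' g₂) = _ := negDim_unitarySum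
      (a := f₂ g₂) (b := f₂' g₂) (by rw [← map_pow, h₂, map_one]) (by rw [← map_pow, h₂, map_one])
    rw [k₁, k₂, (WithLp.linearEquiv 2 ℂ (K × L)).finrank_eq, finrank_prod, Prod.mk_add_mk]
    push_cast
    ring_nf

theorem isFlexiblyHSStable_amalgamatedProduct {G₁ G₂ H : Type*} [Group G₁] [Group G₂] [Group H]
    [Group.FG G₁] [Group.FG G₂] (i₁ : H →* G₁) (i₂ : H →* G₂)
    (hi₁ : Function.Injective i₁) (hi₂ : Function.Injective i₂)
    (ha₁ : IsHSApproximated G₁) (ha₂ : IsHSApproximated G₂) (hs₁ : IsHSStable G₁)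
    (hs₂ : IsHSStable G₂) (hrank : Module.rank ℤ (LambdaHS H) = 2) :
    IsFlexiblyHSStable (AmalgamatedProduct i₁ i₂) := by
  have hd := isBiinvariantDist_hsDist
  have := Group.FG.countable G₁
  have := Group.FG.countable G₂
  have hr₁ := fun h (hh : h ≠ 1) => hd.exists_hom_ne_one ha₁ hs₁ ((map_ne_one_iff i₁ hi₁).2 hh)
  have hr₂ := fun h (hh : h ≠ 1) => hd.exists_hom_ne_one ha₂ hs₂ ((map_ne_one_iff i₂ hi₂).2 hh)
  obtain ⟨h₀, hpow, hne, hgen⟩ := IrrUnitaryRep.exists_involution_generator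
    (fun h hh => let ⟨X, ψ, hψ⟩ := hr₁ h hh; ⟨X, ψ.comp i₁, hψ⟩) hrank
  have hpow₁ : i₁ h₀ ^ 2 = 1 := by rw [← map_pow, hpow, map_one]
  have hpow₂ : i₂ h₀ ^ 2 = 1 := by rw [← map_pow, hpow, map_one]
  have hinv₁ : ∀ {A : Type} [Group A] (f : G₁ →* A), f (i₁ h₀) ^ 2 = 1 := fun f => by
    rw [← map_pow, hpow₁, map_one]
  have hinv₂ : ∀ {A : Type} [Group A] (f : G₂ →* A), f (i₂ h₀) ^ 2 = 1 := fun f => by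
    rw [← map_pow, hpow₂, map_one]
  obtain ⟨K₁, κ₁, hκ₁⟩ := hr₁ h₀ hne
  obtain ⟨K₂, κ₂, hκ₂⟩ := hr₂ h₀ hne
  let R := negDimDiff hpow₁ hpow₂
  obtain ⟨C, hC0, hC⟩ := R.exists_neg_fst_mem
    ⟨K₁, inferInstance, inferInstance, inferInstance, κ₁, 1, rfl⟩
    (by simpa [negDim_one] using negDim_pos (hinv₁ κ₁) hκ₁)
    ⟨K₂, inferInstance, inferInstance, inferInstance, 1, κ₂, rfl⟩
    (by simpa [negDim_one] using negDim_pos (hinv₂ κ₂) hκ₂)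
  intro X φ hφ
  obtain ⟨ψ₁, hψ₁⟩ := hs₁ X (fun n g => φ n (AmalgamatedProduct.inl i₁ i₂ g))
    fun a b => by simpa only [map_mul] using hφ (AmalgamatedProduct.inl i₁ i₂ a) _
  obtain ⟨ψ₂, hψ₂⟩ := hs₂ X (fun n g => φ n (AmalgamatedProduct.inr i₁ i₂ g))
    fun a b => by simpa only [map_mul] using hφ (AmalgamatedProduct.inr i₁ i₂ a) _
  have hUV : Tendsto (fun n => hsDist (X n) (ψ₁ n (i₁ h₀)) (ψ₂ n (i₂ h₀))) atTop (𝓝 0) := by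
    have hlim := (hψ₁ (i₁ h₀)).add (hψ₂ (i₂ h₀))
    rw [add_zero] at hlim
    refine squeeze_zero (fun n => hd.nonneg _ _ _) (fun n => ?_) hlim
    refine (hd.triangle _ _ _ _).trans (add_le_add (hd.comm _ _ _).le (le_of_eq ?_))
    rw [AmalgamatedProduct.inl_eq_inr]
  choose k hkR hk using fun n => hC _
    ⟨X n, inferInstance, inferInstance, inferInstance, ψ₁ n, ψ₂ n, rfl⟩
  choose K hK₁ hK₂ hK₃ f₁ f₂ hf using hkR
  have hkR0 : Tendsto (fun n => (finrank ℂ (K n) : ℝ) / finrank ℂ (X n)) atTop (𝓝 0) := by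
    have hlim := hUV.const_mul C
    rw [mul_zero] at hlim
    refine squeeze_zero (fun n => by positivity) (fun n => ?_) hlim
    have hX := (X n).finrank_pos
    have hkn : k n = finrank ℂ (K n) := congrArg Prod.snd (hf n)
    -- The difference of eigenspace dimensions is at most `dim (X n)` times the normalized distance,
    -- so the added dimension is negligible relative to `X n`.
    rw [← hkn, div_le_iff₀ hX, mul_assoc]
    refine (hk n).trans (mul_le_mul_of_nonneg_left ?_ hC0)
    push_cast
    refine (abs_negDim_sub_le (hinv₁ (ψ₁ n)) (hinv₂ (ψ₂ n))).trans_eq ?_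
    rw [hsDist_eq, Real.sqrt_mul hX.le, Real.sqrt_div (unitaryDistSq_nonneg _ _)]
    have hs := Real.mul_self_sqrt hX.le
    have hs0 := Real.sqrt_pos.2 hX
    rw [div_mul_eq_mul_div, eq_div_iff hs0.ne']
    linear_combination Real.sqrt (unitaryDistSq (ψ₁ n (i₁ h₀)) (ψ₂ n (i₂ h₀))) * hs
  let Y : ℕ → FDHilb := fun n => (X n).sum (K n)
  let χ₁ : ∀ n, G₁ →* UAut (Y n) := fun n => UAut.sumHom (ψ₁ n) (f₁ n)
  let χ₂ : ∀ n, G₂ →* UAut (Y n) := fun n => UAut.sumHom (ψ₂ n) (f₂ n)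
  have hneg : ∀ n, negDim (χ₁ n (i₁ h₀)) = negDim (χ₂ n (i₂ h₀)) := fun n => by
    have h1 := congrArg Prod.fst (hf n)
    have h2 := negDim_unitarySum (hinv₁ (ψ₁ n)) (hinv₁ (f₁ n))
    have h3 := negDim_unitarySum (hinv₂ (ψ₂ n)) (hinv₂ (f₂ n))
    refine h2.trans (Eq.trans ?_ h3.symm)
    dsimp only at h1
    omega
  choose W hW hWle using fun n =>
    exists_conj_of_negDim_eq (hinv₁ (χ₁ n)) (hinv₂ (χ₂ n)) (hneg n)
  have hclose : ∀ {a b : ∀ n, UAut (X n)} (c e : ∀ n, K n ≃ₗᵢ[ℂ] K n),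
      Tendsto (fun n => hsDist (X n) (a n) (b n)) atTop (𝓝 0) →
      Tendsto (fun n => hsDist (Y n) ((a n).sum (c n)) ((b n).sum (e n))) atTop (𝓝 0) := by
    intro a b c e h
    have hlim := h.add (hkR0.const_mul 4).sqrt
    rw [mul_zero, Real.sqrt_zero, add_zero] at hlim
    exact squeeze_zero (fun n => hd.nonneg _ _ _) (fun n => hsDist_sum_le _ _ _ _) hlim
  obtain ⟨ψ, hψ⟩ := hd.exists_amalgam_hom (Y := Y) (φ := fun n a => (φ n a).sum 1)
    (fun a b => squeeze_zero (fun n => hd.nonneg _ _ _)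
      (fun n => by rw [UAut.sum_mul, one_mul]; exact hsDist_sum_one _ _) (hφ a b))
    χ₁ χ₂ W (fun g => hclose _ _ (hψ₁ g)) (fun g => hclose _ _ (hψ₂ g))
    (squeeze_zero (fun n => hd.nonneg _ _ _)
      (fun n => Real.sqrt_le_sqrt (div_le_div_of_nonneg_right (hWle n) (Nat.cast_nonneg _)))
      (hclose (fun n => f₁ n (i₁ h₀)) (fun n => f₂ n (i₂ h₀)) hUV))
    (fun n => MonoidHom.conj_eq_of_forall_mem_zpowers (f₁ := (χ₁ n).comp i₁)
      (f₂ := (χ₂ n).comp i₂) hgen (hW n))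
  have hratio : Tendsto (fun n => (finrank ℂ (Y n) : ℝ) / finrank ℂ (X n)) atTop (𝓝 1) := by
    have hlim := hkR0.const_add 1
    rw [add_zero] at hlim
    refine hlim.congr fun n => ?_
    have hX := (X n).finrank_pos
    rw [FDHilb.finrank_sum]
    push_cast
    rw [add_div, div_self hX.ne']
  refine ⟨Y, fun n => (X n).inl (K n), ψ, fun a => ?_, hratio⟩
  -- Passing from the normalization of `Y n` to that of `X n` costs the square root of the ratio of
  -- dimensions.
  have hlim := (hψ a).mul hratio.sqrt
  rw [zero_mul] at hlim
  exact squeeze_zero (fun n => Real.sqrt_nonneg _) (fun n => hsNorm_sub_compression_le _ _) hlim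

theorem mainTheorem11 {G₁ G₂ H : Type*} [Group G₁] [Group G₂] [Group H]
    [Group.FG G₁] [Group.FG G₂]
    (i₁ : H →* G₁) (i₂ : H →* G₂)
    (hi₁ : Function.Injective i₁) (hi₂ : Function.Injective i₂) :
    (IsHSApproximated G₁ → IsHSApproximated G₂ → IsHSStable G₁ → IsHSStable G₂ →
      Module.rank ℤ (LambdaHS H) = 2 →
      IsFlexiblyHSStable (AmalgamatedProduct i₁ i₂)) ∧
    (IsPApproximated G₁ → IsPApproximated G₂ → IsPStable G₁ → IsPStable G₂ →
      Module.rank ℤ (LambdaP H) = 2 →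
      IsFlexiblyPStable (AmalgamatedProduct i₁ i₂)) :=
  ⟨isFlexiblyHSStable_amalgamatedProduct i₁ i₂ hi₁ hi₂,
    isFlexiblyPStable_amalgamatedProduct i₁ i₂ hi₁ hi₂⟩
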